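/- Let $Sp(n)$ be the compact Lie group of $n\times n$ quaternionic unitary matrices, regarded as a subgroup of $SU(2n)$ in the standard way, so that a homomorphism $Sp(1)\to Sp(3)$ is also a complex representation of $Sp(1)$ of dimension $6$. For $i\ge 0$ let $\phi_i$ denote the irreducible complex representation of $Sp(1)$ of dimension $i+1$, i.e. the $i$-th symmetric power of the standard representation on $\mathbb{C}^2$. An action of a group $U$ on a set $X$ is called effectively free if every element of $U$ that fixes some point of $X$ fixes all points of $X$. **Proposition.** Let $f_1,f_2:Sp(1)\to Sp(3)$ be continuous homomorphisms with $f_1$ nontrivial. Then the biquotient action of $Sp(1)$ on $Sp(3)$ given by $u* g=f_1(u)\,g\,f_2(u)^{-1}$ is effectively free if and only if either $f_2$ is trivial or, up to interchanging $f_1$ and $f_2$, the representations $(f_1,f_2)$ are equivalent (each component separately) to one of the following $10$ pairs: $$\begin{array}{ll} (4\phi_0+\phi_1,\ 2\phi_0+2\phi_1), & (4\phi_0+\phi_1,\ 3\phi_1),\\ (4\phi_0+\phi_1,\ \phi_1+\phi_3), & (4\phi_0+\phi_1,\ \phi_5),\\ (4\phi_0+\phi_1,\ 2\phi_2), & (3\phi_1,\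 2\phi_0+2\phi_1),\\ (3\phi_1,\ 2\phi_0+\phi_3), & (3\phi_1,\ 2\phi_2),\\ (\phi_1+\phi_3,\ 2\phi_0+\phi_3), & (2\phi_2,\ 2\phi_0+\phi_3). \end{array}$$ -/

import Mathlib

open scoped Quaternion

noncomputable section

namespace SpBiquotient

/-- The group `Sp(n)` of `n × n` quaternionic matrices `A` with `A* A = A A* = 1`, with the
topology induced from the space of all quaternionic matrices. -/
abbrev Sp (n : ℕ) : Type := unitary (Matrix (Fin n) (Fin n) ℍ[ℝ])

/-- The group `Sp(1)`, as the group of unit quaternions. -/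
abbrev SpOne : Type := unitary ℍ[ℝ]

/-- The biquotient action `u * g = f₁(u) g f₂(u)⁻¹` of `U` on `G` defined by a pair of
homomorphisms `f₁, f₂ : U → G`. -/
abbrev biquotientAction {U G : Type*} [Group U] [Group G] (f₁ f₂ : U →* G) : MulAction U G where
  smul u g := f₁ u * g * (f₂ u)⁻¹
  one_smul g := by
    change f₁ 1 * g * (f₂ 1)⁻¹ = g
    simp
  mul_smul u v g := by
    change f₁ (u * v) * g * (f₂ (u * v))⁻¹ = f₁ u * (f₁ v * g * (f₂ v)⁻¹) * (f₂ u)⁻¹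
    simp [mul_assoc]

/-- An action of `U` on `X` is effectively free if every element of `U` that fixes some point
fixes all points, that is, if `U` modulo the kernel of the action acts freely. -/
def IsEffectivelyFree {U X : Type*} [Group U] (act : MulAction U X) : Prop :=
  ∀ (u : U) (x : X), act.smul u x = x → ∀ y : X, act.smul u y = y

/-- The embedding of the quaternions into the complex `2 × 2` matrices which sends `a + b j`
(`a b : ℂ`) to the matrix with rows `(a, b)` and `(-conj b, conj a)`. -/
def quatToMatrix : ℍ[ℝ] →+* Matrix (Fin 2) (Fin 2) ℂ where
  toFun q := !![(⟨q.re, q.imI⟩ : ℂ), ⟨q.imJ, q.imK⟩; ⟨-q.imJ, q.imK⟩, ⟨q.re, -q.imI⟩]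
  map_one' := by
    ext i j
    fin_cases i <;> fin_cases j <;> simp [Complex.ext_iff]
  map_mul' p q := by
    ext i j
    fin_cases i <;> fin_cases j <;> simp [Complex.ext_iff, Matrix.mul_apply] <;>
      constructor <;> ring
  map_zero' := by
    ext i j
    fin_cases i <;> fin_cases j <;> simp [Complex.ext_iff]
  map_add' p q := by
    ext i j
    fin_cases i <;> fin_cases j <;> simp [Complex.ext_iff]
    all_goals ring

/-- The standard complex representation of `Sp(n)` on `ℂ²ⁿ`, that is, the natural inclusion
`Sp(n) ⊆ SU(2n)`: each quaternionic entry is replaced by its complex `2 × 2` matrix. -/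
def stdRep (n : ℕ) : Representation ℂ (Sp n) (Fin n × Fin 2 → ℂ) where
  toFun A := Matrix.toLin'
    (Matrix.compRingEquiv (Fin n) (Fin 2) ℂ (quatToMatrix.mapMatrix (A : Matrix _ _ ℍ[ℝ])))
  map_one' := by
    rw [OneMemClass.coe_one, map_one, map_one, Matrix.toLin'_one]
    rfl
  map_mul' A B := by
    rw [Submonoid.coe_mul, map_mul, map_mul, Matrix.toLin'_mul]
    rfl

/-- The linear substitution `X_j ↦ ∑ᵢ M i j X_i` on complex polynomials in two variables. -/
def substitution (M : Matrix (Fin 2) (Fin 2) ℂ) :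
    MvPolynomial (Fin 2) ℂ →ₐ[ℂ] MvPolynomial (Fin 2) ℂ :=
  MvPolynomial.aeval fun j => ∑ i, MvPolynomial.C (M i j) * MvPolynomial.X i

theorem substitution_one : substitution 1 = AlgHom.id ℂ _ := by
  refine MvPolynomial.algHom_ext fun j => ?_
  fin_cases j <;> simp [substitution]

theorem substitution_mul (M N : Matrix (Fin 2) (Fin 2) ℂ) :
    substitution (M * N) = (substitution M).comp (substitution N) := by
  refine MvPolynomial.algHom_ext fun j => ?_
  simp only [substitution, AlgHom.comp_apply, MvPolynomial.aeval_X, Fin.sum_univ_two,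
    Matrix.mul_apply, map_add, map_mul, MvPolynomial.aeval_C, MvPolynomial.algebraMap_eq]
  ring

theorem substitution_mem (M : Matrix (Fin 2) (Fin 2) ℂ) (k : ℕ) (p : MvPolynomial (Fin 2) ℂ)
    (hp : p ∈ MvPolynomial.homogeneousSubmodule (Fin 2) ℂ k) :
    substitution M p ∈ MvPolynomial.homogeneousSubmodule (Fin 2) ℂ k := by
  rw [MvPolynomial.mem_homogeneousSubmodule] at hp ⊢
  have h := MvPolynomial.IsHomogeneous.aeval (n := 1) hp
    (fun j => ∑ i, MvPolynomial.C (M i j) * MvPolynomial.X i)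
    (fun j => MvPolynomial.IsHomogeneous.sum _ _ _ fun i _ => by
      simpa using (MvPolynomial.isHomogeneous_C (Fin 2) (M i j)).mul
        (MvPolynomial.isHomogeneous_X ℂ i))
  simpa [substitution] using h

/-- The irreducible complex representation `φ_k` of `Sp(1)` of dimension `k + 1`: the `k`-th
symmetric power of the standard representation on `ℂ²`, realized on the homogeneous polynomials
of degree `k` in two variables. -/
def phi (k : ℕ) : Representation ℂ SpOne (MvPolynomial.homogeneousSubmodule (Fin 2) ℂ k) where
  toFun q := (substitution (quatToMatrix (q : ℍ[ℝ]))).toLinearMap.restrict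
    (substitution_mem _ k)
  map_one' := by
    ext1 p
    apply Subtype.ext
    simp [substitution_one]
  map_mul' q r := by
    ext1 p
    apply Subtype.ext
    simp only [Submonoid.coe_mul, map_mul, substitution_mul]
    rfl

/-- The direct sum `φ_{k₁} + ⋯ + φ_{k_m}` for a list `[k₁, …, k_m]`. -/
def phiSum (l : List ℕ) : Representation ℂ SpOne
    (DirectSum (Fin l.length) fun i => MvPolynomial.homogeneousSubmodule (Fin 2) ℂ (l.get i)) :=
  Representation.directSum fun i => phi (l.get i)

/-- The homomorphism `f : Sp(1) → Sp(3)`, regarded as a complex representation of dimension 6,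
is equivalent to `φ_{k₁} + ⋯ + φ_{k_m}`, where `l = [k₁, …, k_m]`. -/
def IsEquivalentTo (f : SpOne →* Sp 3) (l : List ℕ) : Prop :=
  Nonempty (Representation.Equiv ((stdRep 3).comp f) (phiSum l))

/-- The ten pairs of representations, each representation being given by the list of the indices
`k` of its irreducible summands `φ_k`, repeated according to multiplicity. -/
def pairTable : List (List ℕ × List ℕ) :=
  [ ([0, 0, 0, 0, 1], [0, 0, 1, 1]),
    ([0, 0, 0, 0, 1], [1, 1, 1]),
    ([0, 0, 0, 0, 1], [1, 3]),
    ([0, 0, 0, 0, 1], [5]),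
    ([0, 0, 0, 0, 1], [2, 2]),
    ([1, 1, 1], [0, 0, 1, 1]),
    ([1, 1, 1], [0, 0, 3]),
    ([1, 1, 1], [2, 2]),
    ([1, 3], [0, 0, 3]),
    ([2, 2], [0, 0, 3]) ]

end SpBiquotient

end

/-! An element u fixes some g exactly when f₁(u) and f₂(u) are conjugate in Sp(3), and it fixes
every g exactly when f₁(u) = f₂(u) is central, that is, ±1. Conjugacy in Sp(3) is decided by traces.
Every element is conjugate to a diagonal one with entries on the upper half circle
(`exists_conj_spDiagonal`), only the three real parts up to order matter, and these are recovered
from the traces of A, A² and A³ (`exists_conj_of_character_pow_eq`). Effective freeness thus becomes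
a question about the characters of f₁ and f₂, which are polynomials in x = 2 Re u, at the traces x,
x² - 2, x³ - 3x of u, u², u³.

Only finitely many characters occur. Haar averaging, together with Weierstrass approximation of
class functions, shows that every continuous representation of Sp(1) is a sum of φ_k
(`exists_equiv_phiPi`). The quaternionic structure on ℂ⁶ makes the multiplicity of φ_0 even, and in
dimension six this leaves seven nontrivial types (`exists_isEquivalentTo`).

For each pair of types, either the pair is in the table, in one of the two orders, and equal traces
at u and u² force u = 1 (`eq_two_of_mem_pairTable`), or an element of order 3, 4 or 5 is sent to
conjugate non-central elements (`mem_pairTable_or_isCoincidence`). -/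

noncomputable section

namespace SpBiquotient

/-! ### Unit quaternions and their conjugacy classes. -/

/-- The quaternion `a + b i + c j + d k`. -/
def quat (a b c d : ℝ) : ℍ[ℝ] := ⟨a, b, c, d⟩

@[simp] theorem quat_re (a b c d : ℝ) : (quat a b c d).re = a := rfl
@[simp] theorem quat_imI (a b c d : ℝ) : (quat a b c d).imI = b := rfl
@[simp] theorem quat_imJ (a b c d : ℝ) : (quat a b c d).imJ = c := rfl
@[simp] theorem quat_imK (a b c d : ℝ) : (quat a b c d).imK = d := rfl

theorem mem_unitary_quaternion_iff {q : ℍ[ℝ]} :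
    q ∈ unitary ℍ[ℝ] ↔ q.re ^ 2 + q.imI ^ 2 + q.imJ ^ 2 + q.imK ^ 2 = 1 := by
  rw [Unitary.mem_iff, Quaternion.star_mul_self, Quaternion.self_mul_star, and_self,
    ← Quaternion.coe_one, Quaternion.coe_inj, Quaternion.normSq_def']

theorem SpOne.sq_add_sq (u : SpOne) :
    (u : ℍ[ℝ]).re ^ 2 + (u : ℍ[ℝ]).imI ^ 2 + (u : ℍ[ℝ]).imJ ^ 2 + (u : ℍ[ℝ]).imK ^ 2 = 1 :=
  mem_unitary_quaternion_iff.1 u.2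

/-- The element `cos θ + i sin θ` of the standard maximal torus of `Sp(1)`. -/
def torus (θ : ℝ) : SpOne :=
  ⟨quat (Real.cos θ) (Real.sin θ) 0 0, mem_unitary_quaternion_iff.2 (by simp)⟩

@[simp] theorem coe_torus (θ : ℝ) : (torus θ : ℍ[ℝ]) = quat (Real.cos θ) (Real.sin θ) 0 0 := rfl

/-- Real scalars commute with everything, so c may be normalized to unit length without losing the
relation. -/
theorem exists_conj_of_mul_eq {p q c : ℍ[ℝ]} (hc : c ≠ 0) (h : q * c = c * p) :
    ∃ w : SpOne, q = w * p * star (w : ℍ[ℝ]) := by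
  have hn : Quaternion.normSq c ≠ 0 := by simpa using hc
  have hpos : 0 < Quaternion.normSq c := lt_of_le_of_ne Quaternion.normSq_nonneg hn.symm
  set r : ℝ := (Real.sqrt (Quaternion.normSq c))⁻¹ with hr
  have hr2 : r * r * Quaternion.normSq c = 1 := by
    rw [hr, ← mul_inv, Real.mul_self_sqrt hpos.le, inv_mul_cancel₀ hn]
  have hw : r • c ∈ unitary ℍ[ℝ] := by
    rw [mem_unitary_quaternion_iff]
    refine Eq.trans ?_ hr2
    rw [Quaternion.normSq_def']
    simp
    ring
  refine ⟨⟨r • c, hw⟩, ?_⟩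
  have h1 : (r • c) * star (r • c) = 1 := (Unitary.mem_iff.1 hw).2
  have h2 : q * (r • c) = (r • c) * p := by simp [h]
  change q = (r • c) * p * star (r • c)
  rw [← h2, mul_assoc, h1, mul_one]

/-- Every unit quaternion is conjugate to an element of the upper half circle of the torus. -/
theorem exists_conj_torus (u : SpOne) :
    ∃ w : SpOne, u = w * torus (Real.arccos (u : ℍ[ℝ]).re) * w⁻¹ := by
  have hu := u.sq_add_sq
  set q : ℍ[ℝ] := u.1 with hq
  set r := Real.sqrt (1 - q.re ^ 2) with hr
  have hr2 : r ^ 2 = q.imI ^ 2 + q.imJ ^ 2 + q.imK ^ 2 := by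
    rw [hr, Real.sq_sqrt] <;> nlinarith [sq_nonneg q.imI, sq_nonneg q.imJ, sq_nonneg q.imK]
  have ht : (torus (Real.arccos q.re) : ℍ[ℝ]) = quat q.re r 0 0 := by
    rw [coe_torus, Real.sin_arccos, Real.cos_arccos] <;>
      nlinarith [sq_nonneg q.imI, sq_nonneg q.imJ, sq_nonneg q.imK]
  -- Let v be the imaginary part of q, of length r. Since v² = -r², the quaternion c = v + r i
  -- satisfies v c = c (r i). It vanishes only for v = -r i, and then j serves instead.
  obtain ⟨c, hc, h⟩ : ∃ c : ℍ[ℝ], c ≠ 0 ∧ q * c = c * quat q.re r 0 0 := by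
    by_cases h0 : q.imI + r = 0 ∧ q.imJ = 0 ∧ q.imK = 0
    · obtain ⟨h1, h2, h3⟩ := h0
      refine ⟨quat 0 0 1 0, fun h => by simpa using congrArg QuaternionAlgebra.imJ h, ?_⟩
      have h1 : q.imI = -r := by linarith
      apply Quaternion.ext <;> simp [h1, h2, h3]
    · refine ⟨quat 0 (q.imI + r) q.imJ q.imK, fun h => h0 ?_, ?_⟩
      · have h1 := congrArg QuaternionAlgebra.imI h
        have h2 := congrArg QuaternionAlgebra.imJ h
        have h3 := congrArg QuaternionAlgebra.imK h
        simpa using And.intro h1 (And.intro h2 h3)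
      · apply Quaternion.ext <;> simp <;> linarith
  obtain ⟨w, hw⟩ := exists_conj_of_mul_eq hc h
  refine ⟨w, Subtype.ext ?_⟩
  rw [← ht] at hw
  exact hw

theorem quatToMatrix_torus (θ : ℝ) : quatToMatrix (torus θ) =
    !![Complex.exp (θ * Complex.I), 0; 0, Complex.exp (-(θ * Complex.I))] := by
  have h : -(θ * Complex.I) = ((-θ : ℝ) : ℂ) * Complex.I := by push_cast; ring
  rw [h]
  ext i j
  fin_cases i <;> fin_cases j <;>
    simp [quatToMatrix, Complex.ext_iff, Complex.exp_ofReal_mul_I_re, Complex.exp_ofReal_mul_I_im,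
      -Complex.ofReal_neg, -neg_mul]

/-! ### Binary forms, weights and the character of φ_k. -/

open MvPolynomial in
/-- The monomial `X₀ʲ X₁ᵏ⁻ʲ` as a binary form of degree `k`. -/
def binaryMonomial (k : ℕ) (j : Fin (k + 1)) : homogeneousSubmodule (Fin 2) ℂ k :=
  ⟨X 0 ^ (j : ℕ) * X 1 ^ (k - j), by
    have h := ((isHomogeneous_X ℂ (0 : Fin 2)).pow (j : ℕ)).mul
      ((isHomogeneous_X ℂ (1 : Fin 2)).pow (k - j))
    have hj := j.2
    rw [mem_homogeneousSubmodule]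
    convert h using 1
    omega⟩

open MvPolynomial in
/-- The monomial basis `X₀ʲ X₁ᵏ⁻ʲ` of the space of binary forms of degree `k`. -/
def monomialBasis (k : ℕ) : Module.Basis (Fin (k + 1)) ℂ (homogeneousSubmodule (Fin 2) ℂ k) :=
  Module.Basis.ofEquivFun
    { toFun := fun p j => coeff (Finsupp.single 0 (j : ℕ) + Finsupp.single 1 (k - j)) p.1
      map_add' := fun p q => by ext; simp
      map_smul' := fun c p => by ext; simp
      invFun := fun c => ∑ j, c j • binaryMonomial k j
      left_inv := fun p => by
        apply Subtype.ext
        ext d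
        simp only [AddSubmonoidClass.coe_finsetSum, SetLike.val_smul, coeff_sum, coeff_smul,
          smul_eq_mul]
        simp only [binaryMonomial, X_pow_eq_monomial, monomial_mul, coeff_monomial, mul_ite, mul_one,
          mul_zero]
        have hp := p.2
        rw [mem_homogeneousSubmodule] at hp
        by_cases hd : d 0 + d 1 = k
        · have hd' : d = Finsupp.single 0 (d 0) + Finsupp.single 1 (k - d 0) := by
            ext i
            fin_cases i <;> simp
            omega
          rw [Finset.sum_eq_single (⟨d 0, by omega⟩ : Fin (k + 1))]
          · simp only [← hd', if_true]
          · intro b _ hb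
            rw [if_neg]
            rintro h
            apply hb
            ext
            simp [← h]
          · simp
        · rw [hp.coeff_eq_zero, Finset.sum_eq_zero]
          · intro j _
            rw [if_neg]
            rintro rfl
            have hj := j.2
            apply hd
            simp
            omega
          · simpa [Finsupp.degree_eq_sum] using hd
      right_inv := fun c => by
        ext i
        simp only [AddSubmonoidClass.coe_finsetSum, SetLike.val_smul, coeff_sum, coeff_smul,
          smul_eq_mul]
        simp only [binaryMonomial, X_pow_eq_monomial, monomial_mul, coeff_monomial, mul_ite, mul_one,
          mul_zero]
        rw [Finset.sum_eq_single i]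
        · simp
        · intro b _ hb
          rw [if_neg]
          intro h
          have := DFunLike.congr_fun h 0
          simp at this
          exact hb (Fin.ext this)
        · simp }

open MvPolynomial in
theorem coe_monomialBasis (k : ℕ) (j : Fin (k + 1)) :
    (monomialBasis k j : MvPolynomial (Fin 2) ℂ) = X 0 ^ (j : ℕ) * X 1 ^ (k - j) := by
  rw [monomialBasis, Module.Basis.coe_ofEquivFun]
  simp [Pi.single_apply, binaryMonomial]

instance (k : ℕ) : FiniteDimensional ℂ (MvPolynomial.homogeneousSubmodule (Fin 2) ℂ k) :=
  (monomialBasis k).finiteDimensional_of_finite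

theorem finrank_homogeneousSubmodule (k : ℕ) :
    Module.finrank ℂ (MvPolynomial.homogeneousSubmodule (Fin 2) ℂ k) = k + 1 := by
  rw [Module.finrank_eq_card_basis (monomialBasis k), Fintype.card_fin]

theorem coe_phi (k : ℕ) (g : SpOne) (p : MvPolynomial.homogeneousSubmodule (Fin 2) ℂ k) :
    (phi k g p : MvPolynomial (Fin 2) ℂ) = substitution (quatToMatrix (g : ℍ[ℝ])) p := rfl

open MvPolynomial in
theorem phi_torus_monomialBasis (k : ℕ) (θ : ℝ) (j : Fin (k + 1)) :
    phi k (torus θ) (monomialBasis k j) =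
      (Complex.exp (θ * Complex.I) ^ (j : ℕ) * Complex.exp (-(θ * Complex.I)) ^ (k - j)) •
        monomialBasis k j := by
  apply Subtype.ext
  rw [coe_phi, quatToMatrix_torus, SetLike.val_smul, coe_monomialBasis]
  simp [substitution, smul_eq_C_mul, mul_pow]
  ring

/-- The sums h_k satisfy h_{k+2} = (z + w) h_{k+1} - z w h_k, which is the recursion of the rescaled
Chebyshev polynomials of the second kind. With z, w the eigenvalues of a torus element this is the
Weyl character formula. -/
theorem sum_pow_mul_pow_eq_chebyshev (x z w : ℂ) (hx : z + w = x) (hzw : z * w = 1) (k : ℕ) :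
    ∑ j ∈ Finset.range (k + 1), z ^ j * w ^ (k - j) = (Polynomial.Chebyshev.S ℂ k).eval x := by
  induction k using Nat.twoStepInduction with
  | zero => simp
  | one => simp [Finset.sum_range_succ, ← hx, add_comm]
  | more n h1 h2 =>
    have h3 : ((n + 1 + 1 : ℕ) : ℤ) = (n : ℤ) + 2 := by push_cast; ring
    rw [h3, Polynomial.Chebyshev.S_add_two]
    have e1 : ∀ m : ℕ, ∑ j ∈ Finset.range (m + 1 + 1), z ^ j * w ^ (m + 1 - j) =
        z ^ (m + 1) + w * ∑ j ∈ Finset.range (m + 1), z ^ j * w ^ (m - j) := by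
      intro m
      rw [Finset.sum_range_succ, Finset.mul_sum, add_comm]
      congr 1
      · simp
      · refine Finset.sum_congr rfl fun j hj => ?_
        have := Finset.mem_range.1 hj
        rw [show m + 1 - j = (m - j) + 1 by omega]
        ring
    have h4 : ((n + 1 : ℕ) : ℤ) = (n : ℤ) + 1 := by push_cast; ring
    rw [h4] at h2
    simp only [Polynomial.eval_sub, Polynomial.eval_mul, Polynomial.eval_X, ← h1, ← h2]
    rw [e1 (n + 1), e1 n, ← hx]
    linear_combination -(∑ j ∈ Finset.range (n + 1), z ^ j * w ^ (n - j)) * hzw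

/-- The value of the character of `φ_k` at the elements of `Sp(1)` whose complex trace is `x`. -/
def phiChar (k : ℕ) (x : ℝ) : ℝ := (Polynomial.Chebyshev.S ℝ k).eval x

theorem character_phi (k : ℕ) (g : SpOne) :
    (phi k).character g = (phiChar k (2 * (g : ℍ[ℝ]).re) : ℂ) := by
  obtain ⟨w, hw⟩ := exists_conj_torus g
  have hg := g.sq_add_sq
  have hcos : Real.cos (Real.arccos (g : ℍ[ℝ]).re) = (g : ℍ[ℝ]).re := by
    rw [Real.cos_arccos] <;> nlinarith [sq_nonneg (g : ℍ[ℝ]).imI, sq_nonneg (g : ℍ[ℝ]).imJ,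
      sq_nonneg (g : ℍ[ℝ]).imK]
  set θ := Real.arccos (g : ℍ[ℝ]).re with hθ
  rw [← hcos, hw, Representation.char_conj, Representation.character,
    LinearMap.trace_eq_matrix_trace _ (monomialBasis k), Matrix.trace]
  simp only [Matrix.diag_apply, LinearMap.toMatrix_apply, phi_torus_monomialBasis, map_smul,
    Module.Basis.repr_self, Finsupp.smul_apply, Finsupp.single_eq_same, smul_eq_mul, mul_one]
  rw [Fin.sum_univ_eq_sum_range (fun j => Complex.exp (θ * Complex.I) ^ j *
    Complex.exp (-(θ * Complex.I)) ^ (k - j)),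
    sum_pow_mul_pow_eq_chebyshev ((2 * Real.cos θ : ℝ) : ℂ)]
  · rw [phiChar, ← Polynomial.Chebyshev.map_S (algebraMap ℝ ℂ) k]
    exact (Polynomial.eval_map_algebraMap _ _).trans (by
      rw [← Complex.coe_algebraMap, Polynomial.aeval_algebraMap_apply]
      simp)
  · rw [Complex.ofReal_mul, Complex.ofReal_cos, Complex.cos]
    push_cast
    ring_nf
  · rw [← Complex.exp_add]
    simp

/-! ### Irreducibility of φ_k. -/

theorem exp_pow_mul_exp_neg_pow_injective (k : ℕ) :
    Function.Injective fun j : Fin (k + 1) =>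
      Complex.exp ((Real.pi / (k + 1) : ℝ) * Complex.I) ^ (j : ℕ) *
        Complex.exp (-((Real.pi / (k + 1) : ℝ) * Complex.I)) ^ (k - j) := by
  intro i j h
  have hi := i.2
  have hj := j.2
  simp only [← Complex.exp_nat_mul, ← Complex.exp_add] at h
  obtain ⟨n, hn⟩ := Complex.exp_eq_exp_iff_exists_int.1 h
  rw [Nat.cast_sub (by omega), Nat.cast_sub (by omega)] at hn
  have hk : ((k : ℂ) + 1) ≠ 0 := by exact_mod_cast (Nat.succ_ne_zero k)
  have hpi : (Real.pi : ℂ) ≠ 0 := by exact_mod_cast Real.pi_ne_zero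
  -- The weights are 2j - k, so equal values at the angle π/(k+1) make i - j a multiple of k + 1,
  -- whereas |i - j| ≤ k. A single torus element therefore separates all weights.
  have h1 : ((i : ℕ) : ℂ) - (j : ℕ) = n * (k + 1) := by
    push_cast at hn
    field_simp at hn
    have h2 : (2 : ℂ) * (((i : ℕ) : ℂ) - (j : ℕ) - n * (k + 1)) = 0 := by linear_combination hn
    have h3 := (mul_eq_zero.1 h2).resolve_left two_ne_zero
    linear_combination h3
  have h2 : ((i : ℕ) : ℤ) - (j : ℕ) = n * (k + 1) := by exact_mod_cast h1
  have h3 : n = 0 := by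
    have a1 : n < 1 := by
      by_contra hc
      nlinarith
    have a2 : -1 < n := by
      by_contra hc
      nlinarith
    omega
  rw [h3] at h2
  ext
  omega

theorem monomialBasis_mem_of_repr_ne_zero {k : ℕ}
    {S : Submodule ℂ (MvPolynomial.homogeneousSubmodule (Fin 2) ℂ k)}
    (hS : ∀ g, ∀ v ∈ S, phi k g v ∈ S) {v} (hv : v ∈ S) {j : Fin (k + 1)}
    (hj : (monomialBasis k).repr v j ≠ 0) : monomialBasis k j ∈ S := by
  set b := monomialBasis k
  set D := phi k (torus (Real.pi / (k + 1) : ℝ)) with hD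
  set c : Fin (k + 1) → ℂ := fun j => Complex.exp ((Real.pi / (k + 1) : ℝ) * Complex.I) ^ (j : ℕ) *
        Complex.exp (-((Real.pi / (k + 1) : ℝ) * Complex.I)) ^ (k - j) with hc
  have hDb : ∀ i, D (b i) = c i • b i := fun i => phi_torus_monomialBasis k _ i
  -- P vanishes at every eigenvalue of D except that of the j-th monomial, so P(D) projects v, up to
  -- a nonzero factor, to its j-th component.
  set P : Polynomial ℂ := ∏ i ∈ Finset.univ.erase j, (Polynomial.X - Polynomial.C (c i)) with hP
  have hmem : Polynomial.aeval D P v ∈ S := by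
    rw [Polynomial.aeval_endomorphism]
    refine Submodule.sum_mem _ fun n hn => S.smul_mem _ ?_
    clear hn
    induction n with
    | zero => simpa using hv
    | succ n ih =>
      rw [pow_succ', Module.End.mul_apply]
      exact hS (torus (Real.pi / (k + 1) : ℝ)) ((D ^ n) v) ih
  have hPb : ∀ i, Polynomial.aeval D P (b i) = P.eval (c i) • b i := fun i =>
    Module.End.aeval_apply_of_hasEigenvector
      ⟨Module.End.mem_eigenspace_iff.2 (hDb i), b.ne_zero i⟩
  have h0 : ∀ i, i ≠ j → P.eval (c i) = 0 := fun i hi => by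
    rw [hP, Polynomial.eval_prod]
    exact Finset.prod_eq_zero (Finset.mem_erase.2 ⟨hi, Finset.mem_univ i⟩) (by simp)
  have h1 : P.eval (c j) ≠ 0 := by
    rw [hP, Polynomial.eval_prod, Finset.prod_ne_zero_iff]
    intro i hi
    simp only [Polynomial.eval_sub, Polynomial.eval_X, Polynomial.eval_C]
    exact sub_ne_zero.2 fun h =>
      (Finset.mem_erase.1 hi).1 (exp_pow_mul_exp_neg_pow_injective k h.symm)
  have h2 : Polynomial.aeval D P v = (b.repr v j * P.eval (c j)) • b j := by
    conv_lhs => rw [← b.sum_repr v]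
    rw [map_sum, Finset.sum_eq_single j]
    · rw [map_smul, hPb, smul_smul]
    · intro i _ hi
      rw [map_smul, hPb, h0 i hi, zero_smul, smul_zero]
    · simp
  rw [h2] at hmem
  exact (S.smul_mem_iff (mul_ne_zero hj h1)).1 hmem

/-- The unit quaternion `(1 + j) / √2`. -/
def mixingQuaternion : SpOne :=
  ⟨quat (√2)⁻¹ 0 (√2)⁻¹ 0, mem_unitary_quaternion_iff.2 (by simp; norm_num)⟩

open MvPolynomial in
theorem phi_mixingQuaternion_monomialBasis (k : ℕ) (j : Fin (k + 1)) :
    (phi k mixingQuaternion (monomialBasis k j) : MvPolynomial (Fin 2) ℂ) =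
      C ((√2 : ℂ)⁻¹ ^ k) * ((X 0 - X 1) ^ (j : ℕ) * (X 0 + X 1) ^ (k - j)) := by
  have hj : k = j + (k - j) := by omega
  have hc : (⟨(√2)⁻¹, 0⟩ : ℂ) = (√2 : ℂ)⁻¹ := by
    rw [← Complex.ofReal_inv]; rfl
  have hc' : (⟨-(√2)⁻¹, 0⟩ : ℂ) = -(√2 : ℂ)⁻¹ := by
    rw [← Complex.ofReal_inv, ← Complex.ofReal_neg]; rfl
  have h0 : ∀ i, ∑ x, C (quatToMatrix (mixingQuaternion : ℍ[ℝ]) x i) * X x =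
      (C (√2 : ℂ)⁻¹ * (if i = 0 then X 0 - X 1 else X 0 + X 1) : MvPolynomial (Fin 2) ℂ) := by
    intro i
    fin_cases i <;> simp [Fin.sum_univ_two, quatToMatrix, mixingQuaternion, hc, hc'] <;> ring
  rw [coe_phi, coe_monomialBasis, substitution]
  simp only [map_mul, map_pow, aeval_X, h0]
  have hpow : (C (√2 : ℂ)⁻¹ ^ k : MvPolynomial (Fin 2) ℂ) =
      C (√2 : ℂ)⁻¹ ^ (j : ℕ) * C (√2 : ℂ)⁻¹ ^ (k - j) := by
    rw [← pow_add, ← hj]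
  rw [hpow]
  simp only [mul_pow, if_true, one_ne_zero, if_false]
  ring

open MvPolynomial in
theorem repr_last_eq_eval (k : ℕ) (v : homogeneousSubmodule (Fin 2) ℂ k) :
    (monomialBasis k).repr v (Fin.last k) = eval ![1, 0] (v : MvPolynomial (Fin 2) ℂ) := by
  conv_rhs => rw [← (monomialBasis k).sum_repr v]
  simp only [AddSubmonoidClass.coe_finsetSum, SetLike.val_smul, coe_monomialBasis, map_sum,
    smul_eval, map_mul, map_pow, eval_X]
  rw [Finset.sum_eq_single (Fin.last k)]
  · simp
  · intro i _ hi
    have : k - (i : ℕ) ≠ 0 := by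
      have := Fin.val_lt_last hi
      omega
    simp [this]
  · simp

open MvPolynomial in
/-- The representation `φ_k` is irreducible. -/
theorem phi_eq_bot_or_eq_top {k : ℕ} (S : Submodule ℂ (homogeneousSubmodule (Fin 2) ℂ k))
    (hS : ∀ g, ∀ v ∈ S, phi k g v ∈ S) : S = ⊥ ∨ S = ⊤ := by
  refine or_iff_not_imp_left.2 fun h => ?_
  obtain ⟨v, hv, hv0⟩ := S.ne_bot_iff.1 h
  obtain ⟨j, hj⟩ : ∃ j, (monomialBasis k).repr v j ≠ 0 := by
    by_contra! hc
    exact hv0 ((monomialBasis k).repr.map_eq_zero_iff.1 (Finsupp.ext hc))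
  have hjS := monomialBasis_mem_of_repr_ne_zero hS hv hj
  have hs : (√2 : ℂ)⁻¹ ^ k ≠ 0 := by
    apply pow_ne_zero
    refine inv_ne_zero ?_
    exact_mod_cast (Real.sqrt_pos.2 two_pos).ne'
  -- The mixing element gives every monomial a nonzero component along X₀ᵏ, as evaluation at (1, 0)
  -- shows. Conversely it sends X₀ᵏ to a multiple of (X₀ - X₁)ᵏ, in which no binomial coefficient
  -- vanishes.
  have hlast : monomialBasis k (Fin.last k) ∈ S := by
    refine monomialBasis_mem_of_repr_ne_zero hS (hS mixingQuaternion _ hjS) ?_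
    rw [repr_last_eq_eval, phi_mixingQuaternion_monomialBasis]
    simp
  rw [eq_top_iff, ← (monomialBasis k).span_eq, Submodule.span_le]
  rintro _ ⟨i, rfl⟩
  refine monomialBasis_mem_of_repr_ne_zero hS (hS mixingQuaternion _ hlast) ?_
  have hsum : phi k mixingQuaternion (monomialBasis k (Fin.last k)) =
      ∑ i : Fin (k + 1), ((√2 : ℂ)⁻¹ ^ k * ((-1) ^ (k - i : ℕ) * k.choose i)) •
        monomialBasis k i := by
    apply Subtype.ext
    rw [phi_mixingQuaternion_monomialBasis]
    simp only [AddSubmonoidClass.coe_finsetSum, SetLike.val_smul, coe_monomialBasis]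
    rw [Fin.sum_univ_eq_sum_range fun i => ((√2 : ℂ)⁻¹ ^ k * ((-1) ^ (k - i) * k.choose i)) •
        (X 0 ^ i * X 1 ^ (k - i) : MvPolynomial (Fin 2) ℂ)]
    simp only [Fin.val_last, Nat.sub_self, pow_zero, mul_one]
    rw [sub_eq_add_neg, add_pow, Finset.mul_sum]
    refine Finset.sum_congr rfl fun i _ => ?_
    rw [neg_pow, smul_eq_C_mul]
    simp
    ring
  rw [hsum, Module.Basis.repr_sum_self]
  refine mul_ne_zero hs (mul_ne_zero (pow_ne_zero _ (by norm_num)) ?_)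
  exact_mod_cast (Nat.choose_pos (Nat.lt_succ_iff.1 i.2)).ne'

/-! ### Products of representations and their invariants. -/

namespace RepresentationEquiv

variable {G V W V' W' : Type*} [Monoid G] [AddCommGroup V] [Module ℂ V] [AddCommGroup W]
  [Module ℂ W] [AddCommGroup V'] [Module ℂ V'] [AddCommGroup W'] [Module ℂ W']
  {ρ : Representation ℂ G V} {σ : Representation ℂ G W} {ρ' : Representation ℂ G V'}
  {σ' : Representation ℂ G W'}

/-- The product of two equivalences of representations. -/
def prodCongr (e : ρ.Equiv ρ') (e' : σ.Equiv σ') : (ρ.prod σ).Equiv (ρ'.prod σ') :=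
  .mk (e.toLinearEquiv.prodCongr e'.toLinearEquiv) fun g => by
    have h1 := fun v => LinearMap.congr_fun (e.isIntertwining' g) v
    have h2 := fun v => LinearMap.congr_fun (e'.isIntertwining' g) v
    refine LinearMap.ext fun v => Prod.ext (h1 v.1) (h2 v.2)

/-- Interchanging the first two factors of a triple product of representations. -/
def prodLeftComm (ρ : Representation ℂ G V) (σ : Representation ℂ G W)
    (τ : Representation ℂ G V') : (ρ.prod (σ.prod τ)).Equiv (σ.prod (ρ.prod τ)) :=
  .mk { toFun := fun v => (v.2.1, v.1, v.2.2)
        invFun := fun v => (v.2.1, v.1, v.2.2)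
        map_add' := fun _ _ => rfl
        map_smul' := fun _ _ => rfl
        left_inv := fun _ => rfl
        right_inv := fun _ => rfl } fun _ => rfl

/-- The product of a finite family of representations. -/
def piRep {ι : Type*} {V : ι → Type*} [∀ i, AddCommGroup (V i)] [∀ i, Module ℂ (V i)]
    (ρ : ∀ i, Representation ℂ G (V i)) : Representation ℂ G (∀ i, V i) where
  toFun g := LinearMap.pi fun i => ρ i g ∘ₗ LinearMap.proj i
  map_one' := by ext1 v; funext i; simp
  map_mul' g h := by ext1 v; funext i; simp

/-- A finite direct sum of representations is equivalent to their product. -/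
def directSumEquivPi {ι : Type*} [Fintype ι] {V : ι → Type*} [∀ i, AddCommGroup (V i)]
    [∀ i, Module ℂ (V i)] (ρ : ∀ i, Representation ℂ G (V i)) :
    (Representation.directSum ρ).Equiv (piRep ρ) :=
  .mk (DirectSum.linearEquivFunOnFintype ℂ ι V) fun g => by
    refine LinearMap.ext fun v => ?_
    funext i
    exact DirectSum.lmap_apply (fun i => ρ i g) v i

/-- Splitting off the first factor of a product of representations. -/
def prodEquivPi {n : ℕ} {V : Fin (n + 1) → Type*} [∀ i, AddCommGroup (V i)]
    [∀ i, Module ℂ (V i)] (ρ : ∀ i, Representation ℂ G (V i)) :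
    ((ρ 0).prod (piRep fun i : Fin n => ρ i.succ)).Equiv (piRep ρ) :=
  .mk (Fin.consLinearEquiv ℂ V) fun g => by
    refine LinearMap.ext fun v => ?_
    funext i
    refine Fin.cases ?_ (fun i => ?_) i <;> rfl

/-- The invariants of a product. -/
def invariantsProd {G V W : Type*} [Group G] [AddCommGroup V] [Module ℂ V] [AddCommGroup W]
    [Module ℂ W] (ρ : Representation ℂ G V) (σ : Representation ℂ G W) :
    (ρ.prod σ).invariants ≃ₗ[ℂ] ρ.invariants × σ.invariants where
  toFun v := (⟨v.1.1, fun g => congrArg Prod.fst (v.2 g)⟩,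
    ⟨v.1.2, fun g => congrArg Prod.snd (v.2 g)⟩)
  invFun v := ⟨(v.1.1, v.2.1), fun g => Prod.ext (v.1.2 g) (v.2.2 g)⟩
  map_add' _ _ := rfl
  map_smul' _ _ := rfl
  left_inv _ := rfl
  right_inv _ := rfl

theorem finrank_invariants_prod {G V W : Type*} [Group G] [AddCommGroup V] [Module ℂ V]
    [AddCommGroup W] [Module ℂ W] [FiniteDimensional ℂ V] [FiniteDimensional ℂ W]
    (ρ : Representation ℂ G V) (σ : Representation ℂ G W) :
    Module.finrank ℂ (ρ.prod σ).invariants =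
      Module.finrank ℂ ρ.invariants + Module.finrank ℂ σ.invariants := by
  rw [(invariantsProd _ _).finrank_eq, Module.finrank_prod]

theorem finrank_invariants_eq {G V W : Type*} [Group G] [AddCommGroup V] [Module ℂ V]
    [AddCommGroup W] [Module ℂ W] {ρ : Representation ℂ G V} {σ : Representation ℂ G W}
    (e : ρ.Equiv σ) : Module.finrank ℂ ρ.invariants = Module.finrank ℂ σ.invariants := by
  have h1 : ∀ g v, e.toLinearEquiv (ρ g v) = σ g (e.toLinearEquiv v) :=
    fun g v => LinearMap.congr_fun (e.isIntertwining' g) v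
  have h : ρ.invariants.map e.toLinearEquiv.toLinearMap = σ.invariants := by
    ext w
    constructor
    · rintro ⟨v, hv, rfl⟩ g
      exact (h1 g v).symm.trans (congrArg _ (hv g))
    · intro hw
      refine ⟨e.toLinearEquiv.symm w, fun g => ?_, e.toLinearEquiv.apply_symm_apply w⟩
      apply e.toLinearEquiv.injective
      rw [h1, e.toLinearEquiv.apply_symm_apply, hw g]
  rw [← h]
  exact (e.toLinearEquiv.submoduleMap ρ.invariants).finrank_eq

end RepresentationEquiv

open RepresentationEquiv

/-! ### Sums of the φ_k: reordering, dimension, character, invariants. -/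

/-- The product version of `phiSum`. -/
def phiPi (l : List ℕ) : Representation ℂ SpOne
    (∀ i : Fin l.length, MvPolynomial.homogeneousSubmodule (Fin 2) ℂ (l.get i)) :=
  piRep fun i => phi (l.get i)

/-- The identification of `phiSum` with its product version. -/
def phiSumEquivPhiPi (l : List ℕ) : (phiSum l).Equiv (phiPi l) :=
  directSumEquivPi _

/-- `φ_k + (φ_{k₁} + ⋯ + φ_{k_m})` as a sum over the extended list. -/
def phiPiCons (k : ℕ) (l : List ℕ) : ((phi k).prod (phiPi l)).Equiv (phiPi (k :: l)) :=
  prodEquivPi fun i : Fin (l.length + 1) => phi ((k :: l).get i)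

theorem phiPi_equiv_of_perm {l l' : List ℕ} (h : l.Perm l') :
    Nonempty ((phiPi l).Equiv (phiPi l')) := by
  induction h with
  | nil => exact ⟨.refl _⟩
  | cons k _ ih =>
    obtain ⟨e⟩ := ih
    exact ⟨(phiPiCons k _).symm.trans ((prodCongr (.refl _) e).trans (phiPiCons k _))⟩
  | swap k k' l =>
    exact ⟨(phiPiCons k' _).symm.trans ((prodCongr (.refl _) (phiPiCons k _).symm).trans
      ((prodLeftComm _ _ _).trans ((prodCongr (.refl _) (phiPiCons k' _)).trans
        (phiPiCons k _))))⟩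
  | trans _ _ ih ih' =>
    obtain ⟨e⟩ := ih
    obtain ⟨e'⟩ := ih'
    exact ⟨e.trans e'⟩

theorem finrank_phiPi (l : List ℕ) : Module.finrank ℂ
    (∀ i : Fin l.length, MvPolynomial.homogeneousSubmodule (Fin 2) ℂ (l.get i)) =
      (l.map (· + 1)).sum := by
  induction l with
  | nil => simp [Module.finrank_zero_of_subsingleton]
  | cons k l ih =>
    rw [← (phiPiCons k l).toLinearEquiv.finrank_eq, Module.finrank_prod, ih,
      finrank_homogeneousSubmodule]
    simp

theorem character_phiPi (l : List ℕ) (g : SpOne) :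
    (phiPi l).character g = ((l.map fun k => phiChar k (2 * (g : ℍ[ℝ]).re)).sum : ℂ) := by
  induction l with
  | nil =>
    have : phiPi [] g = 0 := LinearMap.ext fun v => funext fun i : Fin 0 => i.elim0
    rw [Representation.character, this]
    simp
  | cons k l ih =>
    rw [← Representation.char_iso (phiPiCons k l), Representation.character]
    have : ((phi k).prod (phiPi l)) g = (phi k g).prodMap (phiPi l g) := rfl
    rw [this, LinearMap.trace_prodMap']
    change (phi k).character g + (phiPi l).character g = _
    rw [ih, character_phi]
    simp

theorem finrank_invariants_phi (k : ℕ) :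
    Module.finrank ℂ (phi k).invariants = if k = 0 then 1 else 0 := by
  split_ifs with hk
  · subst hk
    have : (phi 0).invariants = ⊤ := by
      rw [eq_top_iff, ← (monomialBasis 0).span_eq, Submodule.span_le]
      rintro _ ⟨i, rfl⟩ g
      apply Subtype.ext
      rw [coe_phi, coe_monomialBasis]
      simp
    rw [this, finrank_top, finrank_homogeneousSubmodule]
  · rcases phi_eq_bot_or_eq_top (phi k).invariants (fun g v hv => by rwa [hv g]) with h | h
    · rw [h, finrank_bot]
    · exfalso
      have h1 : monomialBasis k (Fin.last k) ∈ (phi k).invariants := h ▸ Submodule.mem_top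
      -- At angle 1 the monomial X₀ᵏ is multiplied by e^{ik}; if this were 1 with k > 0, then π
      -- would be rational.
      have h2 := h1 (torus 1)
      rw [phi_torus_monomialBasis, ← sub_eq_zero, ← one_smul ℂ (monomialBasis k (Fin.last k)),
        smul_smul, ← sub_smul, smul_eq_zero,
        or_iff_left ((monomialBasis k).ne_zero _)] at h2
      simp [← Complex.exp_nat_mul, sub_eq_zero] at h2
      obtain ⟨n, hn⟩ := Complex.exp_eq_one_iff.1 h2
      have h3 : (k : ℂ) = n * (2 * Real.pi) := by
        apply mul_right_cancel₀ Complex.I_ne_zero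
        rw [hn]
        ring
      have h4 : (k : ℝ) = n * (2 * Real.pi) := by exact_mod_cast h3
      have hn0 : n ≠ 0 := by
        rintro rfl
        simp at h4
        exact hk h4
      refine irrational_pi ⟨(k : ℚ) / (2 * n), ?_⟩
      push_cast
      rw [h4]
      field_simp

theorem finrank_invariants_phiPi (l : List ℕ) :
    Module.finrank ℂ (phiPi l).invariants = l.count 0 := by
  induction l with
  | nil => 
    have : Subsingleton (phiPi []).invariants :=
      ⟨fun x y => Subtype.ext (funext fun i : Fin 0 => i.elim0)⟩
    simp [Module.finrank_zero_of_subsingleton]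
  | cons k l ih =>
    rw [← finrank_invariants_eq (phiPiCons k l), finrank_invariants_prod,
      ih, finrank_invariants_phi, List.count_cons]
    simp [add_comm]

/-! ### Averaging over a compact group. -/

open MeasureTheory

/-- A finite-dimensional representation is continuous if all its matrix coefficients are. -/
def IsContinuousRep {G V : Type*} [Group G] [TopologicalSpace G] [AddCommGroup V] [Module ℂ V]
    (ρ : Representation ℂ G V) : Prop :=
  ∀ (φ : Module.Dual ℂ V) (v : V), Continuous fun g => φ (ρ g v)

theorem integrable_of_continuous_of_compactSpace {G : Type*} [TopologicalSpace G] [CompactSpace G]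
    [MeasurableSpace G] [BorelSpace G] (μ : Measure G) [IsFiniteMeasureOnCompacts μ] {f : G → ℂ}
    (hf : Continuous f) : Integrable f μ :=
  hf.integrable_of_hasCompactSupport (HasCompactSupport.of_compactSpace f)

section Average

variable {G V W : Type*} [Group G] [TopologicalSpace G] [IsTopologicalGroup G]
  [AddCommGroup V] [Module ℂ V] [AddCommGroup W] [Module ℂ W] [FiniteDimensional ℂ W]
  {ρ : Representation ℂ G V} {σ : Representation ℂ G W}

theorem IsContinuousRep.continuous_conj (hρ : IsContinuousRep ρ) (hσ : IsContinuousRep σ)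
    (T : V →ₗ[ℂ] W) (φ : Module.Dual ℂ W) (v : V) :
    Continuous fun g => φ (σ g (T (ρ g⁻¹ v))) := by
  let b := Module.finBasis ℂ W
  have h : (fun g => φ (σ g (T (ρ g⁻¹ v)))) =
      fun g => ∑ i, (b.coord i ∘ₗ T) (ρ g⁻¹ v) * φ (σ g (b i)) := by
    funext g
    conv_lhs => rw [← b.sum_repr (T (ρ g⁻¹ v))]
    simp only [map_sum, map_smul, smul_eq_mul, LinearMap.comp_apply, Module.Basis.coord_apply]
  rw [h]
  exact continuous_finsetSum _ fun i _ =>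
    ((hρ (b.coord i ∘ₗ T) v).comp continuous_inv).mul (hσ φ (b i))

variable [CompactSpace G] [MeasurableSpace G] [BorelSpace G] (μ : Measure G)
  [IsProbabilityMeasure μ] [μ.IsMulLeftInvariant]

/-- The average of a linear map between two representations of a compact group. -/
theorem exists_average (hρ : IsContinuousRep ρ) (hσ : IsContinuousRep σ) (T : V →ₗ[ℂ] W) :
    ∃ S : V →ₗ[ℂ] W, (∀ (φ : Module.Dual ℂ W) v, φ (S v) = ∫ g, φ (σ g (T (ρ g⁻¹ v))) ∂μ) ∧
      ∀ h v, S (ρ h v) = σ h (S v) := by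
  let b := Module.finBasis ℂ W
  have hint : ∀ (φ : Module.Dual ℂ W) v, Integrable (fun g => φ (σ g (T (ρ g⁻¹ v)))) μ :=
    fun φ v => integrable_of_continuous_of_compactSpace μ (hρ.continuous_conj hσ T φ v)
  let S : V →ₗ[ℂ] W :=
    { toFun := fun v => ∑ i, (∫ g, b.coord i (σ g (T (ρ g⁻¹ v))) ∂μ) • b i
      map_add' := fun v w => by
        simp only [map_add]
        rw [← Finset.sum_add_distrib]
        refine Finset.sum_congr rfl fun i _ => ?_
        rw [integral_add (hint _ _) (hint _ _), add_smul]
      map_smul' := fun c v => by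
        simp only [map_smul, smul_eq_mul, integral_const_mul, RingHom.id_apply, Finset.smul_sum,
          smul_smul] }
  have hS : ∀ (φ : Module.Dual ℂ W) v, φ (S v) = ∫ g, φ (σ g (T (ρ g⁻¹ v))) ∂μ := by
    intro φ v
    have h : ∀ g, φ (σ g (T (ρ g⁻¹ v))) = ∑ i, b.coord i (σ g (T (ρ g⁻¹ v))) * φ (b i) := by
      intro g
      conv_lhs => rw [← b.sum_repr (σ g (T (ρ g⁻¹ v)))]
      simp only [map_sum, map_smul, smul_eq_mul, Module.Basis.coord_apply]
    simp only [h]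
    rw [integral_finsetSum _ fun i _ => (hint _ _).mul_const _]
    simp only [integral_mul_const]
    change φ (∑ i, (∫ g, b.coord i (σ g (T (ρ g⁻¹ v))) ∂μ) • b i) = _
    simp
  refine ⟨S, hS, fun h v => ?_⟩
  refine b.ext_elem fun i => ?_
  change b.coord i _ = (b.coord i ∘ₗ σ h) _
  -- Replacing g by h g turns σ(g) T ρ(g⁻¹) ρ(h) into σ(h) σ(g) T ρ(g⁻¹).
  rw [hS, hS, ← integral_mul_left_eq_self _ h]
  simp [map_mul]

/-- Expanded in bases, the integrand is a sum of coefficients of conjugated rank-one maps. Each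
integral is then a coefficient of an averaged map, which intertwines and so is zero by assumption.
-/
theorem integral_character_mul_character_inv [FiniteDimensional ℂ V] (hρ : IsContinuousRep ρ)
    (hσ : IsContinuousRep σ)
    (h0 : ∀ S : V →ₗ[ℂ] W, (∀ h v, S (ρ h v) = σ h (S v)) → S = 0) :
    ∫ g, σ.character g * ρ.character g⁻¹ ∂μ = 0 := by
  let b := Module.finBasis ℂ W
  let c := Module.finBasis ℂ V
  have hc : ∀ g, σ.character g * ρ.character g⁻¹ =
      ∑ i, ∑ j, b.coord i (σ g (((c.coord j).smulRight (b i)) (ρ g⁻¹ (c j)))) := by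
    intro g
    rw [Representation.character, Representation.character, LinearMap.trace_eq_matrix_trace _ b,
      LinearMap.trace_eq_matrix_trace _ c, Matrix.trace, Matrix.trace, Finset.sum_mul_sum]
    refine Finset.sum_congr rfl fun i _ => Finset.sum_congr rfl fun j _ => ?_
    simp [LinearMap.toMatrix_apply, mul_comm]
  have hint : ∀ i j, Integrable
      (fun g => b.coord i (σ g (((c.coord j).smulRight (b i)) (ρ g⁻¹ (c j))))) μ :=
    fun i j => integrable_of_continuous_of_compactSpace μ (hρ.continuous_conj hσ _ _ _)
  simp only [hc]
  rw [integral_finsetSum _ fun i _ => integrable_finsetSum _ fun j _ => hint i j]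
  refine Finset.sum_eq_zero fun i _ => ?_
  rw [integral_finsetSum _ fun j _ => hint i j]
  refine Finset.sum_eq_zero fun j _ => ?_
  obtain ⟨S, hS, hS'⟩ := exists_average μ hρ hσ ((c.coord j).smulRight (b i))
  rw [← hS, h0 S hS']
  simp

end Average

/-- An injective intertwining map between continuous representations of a compact group has an
intertwining left inverse. -/
theorem exists_intertwining_leftInverse {G V W : Type*} [Group G] [TopologicalSpace G]
    [IsTopologicalGroup G] [CompactSpace G] [MeasurableSpace G] [BorelSpace G]
    [AddCommGroup V] [Module ℂ V] [AddCommGroup W] [Module ℂ W] [FiniteDimensional ℂ W]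
    {ρ : Representation ℂ G V} {σ : Representation ℂ G W} (μ : Measure G)
    [IsProbabilityMeasure μ] [μ.IsMulLeftInvariant] (hρ : IsContinuousRep ρ)
    (hσ : IsContinuousRep σ) (T : W →ₗ[ℂ] V) (hT : Function.Injective T)
    (hTi : ∀ h v, T (σ h v) = ρ h (T v)) :
    ∃ S : V →ₗ[ℂ] W, (∀ h v, S (ρ h v) = σ h (S v)) ∧ ∀ w, S (T w) = w := by
  obtain ⟨L, hL⟩ := T.exists_leftInverse_of_injective (LinearMap.ker_eq_bot.2 hT)
  obtain ⟨S, hS, hS'⟩ := exists_average μ hρ hσ L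
  refine ⟨S, hS', fun w => ?_⟩
  refine (Module.finBasis ℂ W).ext_elem fun i => ?_
  change (Module.finBasis ℂ W).coord i _ = (Module.finBasis ℂ W).coord i _
  rw [hS]
  have hL' : ∀ w, L (T w) = w := fun w => LinearMap.congr_fun hL w
  simp [← hTi, hL']

/-! ### Haar measure on Sp(1) and continuity of φ_k. -/

instance : CompactSpace SpOne := by
  have : ProperSpace ℍ[ℝ] := FiniteDimensional.proper ℝ ℍ[ℝ]
  refine isCompact_iff_compactSpace.1 (Metric.isCompact_of_isClosed_isBounded ?_ ?_)
  · exact isClosed_unitary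
  · refine (Metric.isBounded_closedBall (x := (0 : ℍ[ℝ])) (r := 1)).subset fun q hq => ?_
    rw [mem_closedBall_zero_iff]
    exact (CStarRing.norm_of_mem_unitary hq).le

instance : MeasurableSpace SpOne := borel _
instance : BorelSpace SpOne := ⟨rfl⟩

/-- The Haar probability measure on `Sp(1)`. -/
def haarSpOne : Measure SpOne := Measure.haarMeasure ⊤

instance : IsProbabilityMeasure haarSpOne := ⟨by
  have := Measure.haarMeasure_self (K₀ := (⊤ : TopologicalSpace.PositiveCompacts SpOne))
  simpa [haarSpOne] using this⟩

instance : haarSpOne.IsHaarMeasure := by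
  unfold haarSpOne
  infer_instance

theorem continuous_re_spOne : Continuous fun g : SpOne => (g : ℍ[ℝ]).re :=
  Quaternion.continuous_re.comp continuous_subtype_val

theorem continuous_torus : Continuous torus := by
  have h : ∀ θ, quat (Real.cos θ) (Real.sin θ) 0 0 =
      (Real.cos θ : ℍ[ℝ]) + Real.sin θ • quat 0 1 0 0 := by
    intro θ
    apply Quaternion.ext <;> simp
  refine Continuous.subtype_mk ?_ _
  simp only [h]
  exact (Quaternion.continuous_coe.comp Real.continuous_cos).add
    (Real.continuous_sin.smul continuous_const)

open MvPolynomial in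
theorem continuous_coeff_substitution (p : MvPolynomial (Fin 2) ℂ) (d : Fin 2 →₀ ℕ) :
    Continuous fun M : Matrix (Fin 2) (Fin 2) ℂ => coeff d (substitution M p) := by
  induction p using MvPolynomial.induction_on generalizing d with
  | C a => simpa [substitution] using continuous_const
  | add p q hp hq =>
    simp only [map_add, coeff_add]
    exact (hp d).add (hq d)
  | mul_X p i hp =>
    simp only [map_mul, coeff_mul]
    refine continuous_finsetSum _ fun x _ => (hp x.1).mul ?_
    simp only [substitution, aeval_X, coeff_sum, coeff_C_mul]
    fun_prop

theorem continuous_quatToMatrix : Continuous quatToMatrix := by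
  refine continuous_matrix fun i j => ?_
  have h1 := Quaternion.continuous_re
  have h2 := Quaternion.continuous_imI
  have h3 := Quaternion.continuous_imJ
  have h4 := Quaternion.continuous_imK
  have h : ∀ {f g : ℍ[ℝ] → ℝ}, Continuous f → Continuous g →
      Continuous fun q => (⟨f q, g q⟩ : ℂ) := fun hf hg =>
    Complex.equivRealProdCLM.symm.continuous.comp (hf.prodMk hg)
  fin_cases i <;> fin_cases j
  · exact h h1 h2
  · exact h h3 h4
  · exact h h3.neg h4
  · exact h h1 h2.neg

theorem isContinuousRep_phi (k : ℕ) : IsContinuousRep (phi k) := by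
  intro φ v
  have h : ∀ g, φ (phi k g v) = ∑ j, (monomialBasis k).repr (phi k g v) j *
      φ (monomialBasis k j) := by
    intro g
    conv_lhs => rw [← (monomialBasis k).sum_repr (phi k g v)]
    simp only [map_sum, map_smul, smul_eq_mul]
  simp only [h]
  refine continuous_finsetSum _ fun j _ => Continuous.mul ?_ continuous_const
  exact (continuous_coeff_substitution v _).comp
    (continuous_quatToMatrix.comp continuous_subtype_val)


/-! ### Complete reducibility of representations of Sp(1). -/

theorem mul_phiChar_succ (k : ℕ) (x : ℝ) :
    x * phiChar (k + 1) x = phiChar (k + 2) x + phiChar k x := by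
  have h := Polynomial.Chebyshev.S_add_two ℝ (k : ℤ)
  simp only [phiChar]
  push_cast
  rw [h]
  simp

@[simp] theorem phiChar_zero (x : ℝ) : phiChar 0 x = 1 := by simp [phiChar]
@[simp] theorem phiChar_one (x : ℝ) : phiChar 1 x = x := by simp [phiChar]

theorem re_inv_spOne (g : SpOne) : ((g⁻¹ : SpOne) : ℍ[ℝ]).re = (g : ℍ[ℝ]).re :=
  Quaternion.re_star _

theorem abs_re_spOne_le (g : SpOne) : |(g : ℍ[ℝ]).re| ≤ 1 := by
  have := g.sq_add_sq
  rw [abs_le]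
  constructor <;> nlinarith [sq_nonneg (g : ℍ[ℝ]).imI, sq_nonneg (g : ℍ[ℝ]).imJ,
      sq_nonneg (g : ℍ[ℝ]).imK]

theorem character_eq_character_torus {V : Type*} [AddCommGroup V] [Module ℂ V]
    {ρ : Representation ℂ SpOne V} (g : SpOne) :
    ρ.character g = ρ.character (torus (Real.arccos (g : ℍ[ℝ]).re)) := by
  obtain ⟨w, hw⟩ := exists_conj_torus g
  conv_lhs => rw [hw, Representation.char_conj]

section

variable {V : Type*} [AddCommGroup V] [Module ℂ V] [FiniteDimensional ℂ V]
  {ρ : Representation ℂ SpOne V}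

theorem IsContinuousRep.continuous_character (hρ : IsContinuousRep ρ) :
    Continuous ρ.character := by
  let b := Module.finBasis ℂ V
  have h : ρ.character = fun g => ∑ i, b.coord i (ρ g (b i)) := by
    funext g
    rw [Representation.character, LinearMap.trace_eq_matrix_trace _ b, Matrix.trace]
    simp [LinearMap.toMatrix_apply]
  rw [h]
  exact continuous_finsetSum _ fun i _ => hρ _ _

/-- For m = 0 this is orthogonality of characters, since u and u⁻¹ have the same real part. The
Clebsch-Gordan rule `mul_phiChar_succ` absorbs one power of the trace at a time. -/
theorem integral_character_mul_phiChar_eq_zero (hρ : IsContinuousRep ρ)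
    (h0 : ∀ k, ∀ S : MvPolynomial.homogeneousSubmodule (Fin 2) ℂ k →ₗ[ℂ] V,
      (∀ h v, S (phi k h v) = ρ h (S v)) → S = 0) (m k : ℕ) :
    ∫ g : SpOne, ρ.character g * (((2 * (g : ℍ[ℝ]).re) ^ m * phiChar k (2 * (g : ℍ[ℝ]).re) : ℝ) : ℂ)
      ∂haarSpOne = 0 := by
  have hint : ∀ m k : ℕ, Integrable (fun g : SpOne => ρ.character g *
      (((2 * (g : ℍ[ℝ]).re) ^ m * phiChar k (2 * (g : ℍ[ℝ]).re) : ℝ) : ℂ)) haarSpOne := by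
    intro m k
    apply integrable_of_continuous_of_compactSpace
    have h1 := hρ.continuous_character
    have h2 := continuous_re_spOne
    have h3 : Continuous (phiChar k) := (Polynomial.Chebyshev.S ℝ k).continuous
    exact h1.mul (Complex.continuous_ofReal.comp (by fun_prop))
  induction m generalizing k with
  | zero =>
    have h := integral_character_mul_character_inv haarSpOne (isContinuousRep_phi k) hρ (h0 k)
    simpa [character_phi, re_inv_spOne] using h
  | succ m ih =>
    cases k with
    | zero =>
      have h := ih 1
      simpa [pow_succ] using h
    | succ k =>
      have h := congrArg₂ (· + ·) (ih (k + 2)) (ih k)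
      simp only [add_zero] at h
      rw [← integral_add (hint _ _) (hint _ _)] at h
      rw [← h]
      congr 1
      funext g
      rw [← mul_add, ← Complex.ofReal_add, ← mul_add, ← mul_phiChar_succ]
      congr 2
      ring

/-- A continuous representation of `Sp(1)` without intertwining maps from any `φ_k` is zero. -/
theorem finrank_eq_zero_of_forall_intertwining_eq_zero (hρ : IsContinuousRep ρ)
    (h0 : ∀ k, ∀ S : MvPolynomial.homogeneousSubmodule (Fin 2) ℂ k →ₗ[ℂ] V,
      (∀ h v, S (phi k h v) = ρ h (S v)) → S = 0) : Module.finrank ℂ V = 0 := by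
  have hχ := hρ.continuous_character
  have hre := continuous_re_spOne
  have hχi : Integrable (fun g => (ρ.character g).re) haarSpOne :=
    (integrable_of_continuous_of_compactSpace haarSpOne hχ).re
  have hint : ∀ f : ℝ → ℝ, Continuous f →
      Integrable (fun g : SpOne => (ρ.character g).re * f (g : ℍ[ℝ]).re) haarSpOne := by
    intro f hf
    refine Continuous.integrable_of_hasCompactSupport ?_ (HasCompactSupport.of_compactSpace _)
    exact (Complex.continuous_re.comp hχ).mul (hf.comp hre)
  have hmon : ∀ m : ℕ, ∫ g : SpOne, (ρ.character g).re * (g : ℍ[ℝ]).re ^ m ∂haarSpOne = 0 := by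
    intro m
    have h1 := integral_character_mul_phiChar_eq_zero hρ h0 m 0
    have h2 := congrArg Complex.re h1
    have h3 := integral_re (𝕜 := ℂ) (integrable_of_continuous_of_compactSpace haarSpOne
      (f := fun g : SpOne => ρ.character g *
        (((2 * (g : ℍ[ℝ]).re) ^ m * phiChar 0 (2 * (g : ℍ[ℝ]).re) : ℝ) : ℂ))
      (hχ.mul (Complex.continuous_ofReal.comp (by simp only [phiChar_zero]; fun_prop))))
    have h4 := h3.trans h2
    simp only [RCLike.re_eq_complex_re, Complex.re_mul_ofReal, phiChar_zero, mul_one, mul_pow,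
      Complex.zero_re, mul_left_comm _ ((2 : ℝ) ^ m), integral_const_mul] at h4
    exact (mul_eq_zero.1 h4).resolve_left (by positivity)
  have hpoly : ∀ p : Polynomial ℝ,
      ∫ g : SpOne, (ρ.character g).re * p.eval (g : ℍ[ℝ]).re ∂haarSpOne = 0 := by
    intro p
    induction p using Polynomial.induction_on' with
    | add p q hp hq =>
      simp only [Polynomial.eval_add, mul_add]
      rw [integral_add (hint _ p.continuous) (hint _ q.continuous), hp, hq, add_zero]
    | monomial n a =>
      simp only [Polynomial.eval_monomial, mul_left_comm _ a, integral_const_mul, hmon, mul_zero]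
  -- As a class function, Re χ is a continuous function F of Re g. All its moments vanish, so
  -- approximating F by polynomials gives ∫ (Re χ)² = 0.
  set F : ℝ → ℝ := fun x => (ρ.character (torus (Real.arccos x))).re with hF
  have hFc : Continuous F :=
    Complex.continuous_re.comp (hχ.comp (continuous_torus.comp Real.continuous_arccos))
  have hFg : ∀ g : SpOne, (ρ.character g).re = F (g : ℍ[ℝ]).re := fun g =>
    congrArg Complex.re (character_eq_character_torus g)
  have hsq : ∫ g : SpOne, (ρ.character g).re * F (g : ℍ[ℝ]).re ∂haarSpOne = 0 := by
    set A := ∫ g : SpOne, |(ρ.character g).re| ∂haarSpOne with hA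
    have hA0 : 0 ≤ A := integral_nonneg fun _ => abs_nonneg _
    have hbound : ∀ ε > 0, |∫ g : SpOne, (ρ.character g).re * F (g : ℍ[ℝ]).re ∂haarSpOne| ≤
        A * ε := by
      intro ε hε
      obtain ⟨p, hp⟩ := exists_polynomial_near_of_continuousOn (-1) 1 F hFc.continuousOn ε hε
      have hsub := integral_sub (hint _ hFc) (hint _ p.continuous)
      rw [hpoly p] at hsub
      rw [← hsub.trans (sub_zero _)]
      refine (abs_integral_le_integral_abs).trans ?_
      rw [hA, ← integral_mul_const]
      refine integral_mono ((hint _ hFc).sub (hint _ p.continuous)).abs (hχi.abs.mul_const _) ?_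
      intro g
      beta_reduce
      rw [← mul_sub, abs_mul, abs_sub_comm]
      exact mul_le_mul_of_nonneg_left (hp _ (abs_le.1 (abs_re_spOne_le g))).le (abs_nonneg _)
    by_contra hne
    have h1 := abs_pos.2 hne
    -- With B the absolute value of the integral, ε = B / (2(A + 1)) makes A ε < B, even when A = 0.
    have h2 := hbound (|∫ g : SpOne, (ρ.character g).re * F (g : ℍ[ℝ]).re ∂haarSpOne| / (A + 1) / 2)
      (by positivity)
    set B := |∫ g : SpOne, (ρ.character g).re * F (g : ℍ[ℝ]).re ∂haarSpOne|
    have h3 : A * (B / (A + 1) / 2) < B := by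
      rw [div_div, mul_div_assoc', div_lt_iff₀ (by positivity)]
      nlinarith
    linarith
  simp only [← hFg] at hsq
  have hcont : Continuous fun g : SpOne => (ρ.character g).re * (ρ.character g).re :=
    (Complex.continuous_re.comp hχ).mul (Complex.continuous_re.comp hχ)
  by_contra hne
  -- The integrand is continuous and nonnegative, with value (dim V)² at the identity, so a zero
  -- integral forces dim V = 0.
  refine (hcont.integral_pos_of_hasCompactSupport_nonneg_nonzero (μ := haarSpOne)
    (HasCompactSupport.of_compactSpace _) (fun g => mul_self_nonneg _) (x := 1) ?_).ne' hsq
  rw [Representation.char_one]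
  simpa using hne

end

/-- Splitting a representation along an intertwining map with an intertwining left inverse. -/
def splitEquiv {G V W : Type*} [Group G] [AddCommGroup V] [Module ℂ V] [AddCommGroup W]
    [Module ℂ W] {ρ : Representation ℂ G V} {σ : Representation ℂ G W} (S : W →ₗ[ℂ] V)
    (L : V →ₗ[ℂ] W) (hS : ∀ h v, S (σ h v) = ρ h (S v)) (hL : ∀ h v, L (ρ h v) = σ h (L v))
    (hLS : ∀ w, L (S w) = w) :
    (σ.prod (ρ.subrepresentation (LinearMap.ker L) fun h v hv => by
      rw [Submodule.mem_comap, LinearMap.mem_ker, hL, LinearMap.mem_ker.1 hv, map_zero])).Equiv ρ :=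
  .mk
    { toFun := fun x => S x.1 + x.2
      invFun := fun v => (L v, ⟨v - S (L v), by simp [hLS]⟩)
      map_add' := fun x y => by
        simp only [Prod.fst_add, Prod.snd_add, map_add, Submodule.coe_add]
        abel
      map_smul' := fun c x => by simp
      left_inv := fun x => by
        have h : L x.2 = 0 := x.2.2
        refine Prod.ext ?_ (Subtype.ext ?_) <;> simp [h, hLS]
      right_inv := fun v => by simp } fun g => by
    refine LinearMap.ext fun x => ?_
    change S (σ g x.1) + ρ g x.2 = ρ g (S x.1 + x.2)
    rw [hS, map_add]

/-- Every continuous finite-dimensional complex representation of `Sp(1)` is a sum of `φ_k`. -/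
theorem exists_equiv_phiPi {V : Type*} [AddCommGroup V] [Module ℂ V] [FiniteDimensional ℂ V]
    {ρ : Representation ℂ SpOne V} (hρ : IsContinuousRep ρ) :
    ∃ l, Nonempty (ρ.Equiv (phiPi l)) := by
  obtain ⟨n, hn⟩ : ∃ n, Module.finrank ℂ V = n := ⟨_, rfl⟩
  induction n using Nat.strong_induction_on generalizing V with
  | _ n ih =>
    by_cases h0 : Module.finrank ℂ V = 0
    · have := Module.finrank_zero_iff.1 h0
      refine ⟨[], ⟨.mk
        { toFun := fun _ => fun i : Fin 0 => i.elim0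
          invFun := fun _ => 0
          map_add' := fun _ _ => funext fun i : Fin 0 => i.elim0
          map_smul' := fun _ _ => funext fun i : Fin 0 => i.elim0
          left_inv := fun _ => Subsingleton.elim _ _
          right_inv := fun _ => funext fun i : Fin 0 => i.elim0 }
        fun _ => LinearMap.ext fun _ => funext fun i : Fin 0 => i.elim0⟩⟩
    -- Some φ_k maps nontrivially to V, injectively because it is irreducible. An averaged left
    -- inverse L splits it off, and induction applies to ker L.
    · have h1 := mt (finrank_eq_zero_of_forall_intertwining_eq_zero hρ) h0
      push Not at h1
      obtain ⟨k, S, hS, hS0⟩ := h1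
      have hker : LinearMap.ker S = ⊥ := by
        refine (phi_eq_bot_or_eq_top (LinearMap.ker S) fun g v hv => ?_).resolve_right
          fun h => hS0 (LinearMap.ker_eq_top.1 h)
        rw [LinearMap.mem_ker, hS, LinearMap.mem_ker.1 hv, map_zero]
      obtain ⟨L, hL, hLS⟩ := exists_intertwining_leftInverse haarSpOne hρ (isContinuousRep_phi k) S
        (LinearMap.ker_eq_bot.1 hker) hS
      have hlt : Module.finrank ℂ (LinearMap.ker L) < n := by
        rw [← hn]
        refine Submodule.finrank_lt fun h => ?_
        have h2 := hLS (monomialBasis k 0)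
        rw [LinearMap.ker_eq_top.1 h, LinearMap.zero_apply] at h2
        exact (monomialBasis k).ne_zero 0 h2.symm
      let e := splitEquiv S L hS hL hLS
      obtain ⟨l, ⟨e'⟩⟩ := ih _ hlt (ρ := ρ.subrepresentation (LinearMap.ker L) fun h v hv => by
        rw [Submodule.mem_comap, LinearMap.mem_ker, hL, LinearMap.mem_ker.1 hv, map_zero])
        -- Functionals on ker L extend to V, so ker L inherits continuous matrix coefficients.
        (fun φ v => by
          obtain ⟨ψ, hψ⟩ := LinearMap.exists_extend φ
          have h3 := hρ ψ v
          convert! h3 using 2 with g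
          rw [← hψ]
          rfl) rfl
      exact ⟨k :: l, ⟨e.symm.trans ((prodCongr (.refl _) e').trans (phiPiCons k l))⟩⟩

/-! ### Block diagonal quaternionic matrices. -/

theorem coe_sum_quaternion {ι : Type*} (t : Finset ι) (f : ι → ℝ) :
    ((∑ i ∈ t, f i : ℝ) : ℍ[ℝ]) = ∑ i ∈ t, (f i : ℍ[ℝ]) :=
  map_sum (algebraMap ℝ ℍ[ℝ]) f t

section BlockDiagonal

variable {n : ℕ}

/-- The block diagonal matrix with blocks `q` and `A`. -/
def consMatrix (q : ℍ[ℝ]) (A : Matrix (Fin n) (Fin n) ℍ[ℝ]) :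
    Matrix (Fin (n + 1)) (Fin (n + 1)) ℍ[ℝ] :=
  Matrix.of (Fin.cons (Fin.cons q 0) fun i => Fin.cons 0 (A i))

@[simp] theorem consMatrix_zero_zero (q : ℍ[ℝ]) (A : Matrix (Fin n) (Fin n) ℍ[ℝ]) :
    consMatrix q A 0 0 = q := rfl
@[simp] theorem consMatrix_zero_succ (q : ℍ[ℝ]) (A : Matrix (Fin n) (Fin n) ℍ[ℝ]) (j : Fin n) :
    consMatrix q A 0 j.succ = 0 := rfl
@[simp] theorem consMatrix_succ_zero (q : ℍ[ℝ]) (A : Matrix (Fin n) (Fin n) ℍ[ℝ]) (i : Fin n) :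
    consMatrix q A i.succ 0 = 0 := rfl
@[simp] theorem consMatrix_succ_succ (q : ℍ[ℝ]) (A : Matrix (Fin n) (Fin n) ℍ[ℝ]) (i j : Fin n) :
    consMatrix q A i.succ j.succ = A i j := rfl

theorem consMatrix_mul (q q' : ℍ[ℝ]) (A A' : Matrix (Fin n) (Fin n) ℍ[ℝ]) :
    consMatrix q A * consMatrix q' A' = consMatrix (q * q') (A * A') := by
  ext1 i j
  refine Fin.cases ?_ (fun i => ?_) i <;> refine Fin.cases ?_ (fun j => ?_) j <;>
    simp [Matrix.mul_apply, Fin.sum_univ_succ]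

theorem consMatrix_one : consMatrix 1 (1 : Matrix (Fin n) (Fin n) ℍ[ℝ]) = 1 := by
  ext1 i j
  refine Fin.cases ?_ (fun i => ?_) i <;> refine Fin.cases ?_ (fun j => ?_) j <;>
    simp [Matrix.one_apply, Fin.succ_ne_zero, (Fin.succ_ne_zero _).symm]

theorem star_consMatrix (q : ℍ[ℝ]) (A : Matrix (Fin n) (Fin n) ℍ[ℝ]) :
    star (consMatrix q A) = consMatrix (star q) (star A) := by
  ext1 i j
  refine Fin.cases ?_ (fun i => ?_) i <;> refine Fin.cases ?_ (fun j => ?_) j <;>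
    simp [Matrix.star_apply]

theorem consMatrix_mem_unitary_iff {q : ℍ[ℝ]} {A : Matrix (Fin n) (Fin n) ℍ[ℝ]} :
    consMatrix q A ∈ unitary (Matrix (Fin (n + 1)) (Fin (n + 1)) ℍ[ℝ]) ↔
      q ∈ unitary ℍ[ℝ] ∧ A ∈ unitary (Matrix (Fin n) (Fin n) ℍ[ℝ]) := by
  have h : ∀ (q : ℍ[ℝ]) (A : Matrix (Fin n) (Fin n) ℍ[ℝ]),
      consMatrix q A = 1 ↔ q = 1 ∧ A = 1 := by
    refine fun q A => ⟨fun h => ⟨?_, ?_⟩, ?_⟩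
    · simpa using congrFun (congrFun h 0) 0
    · ext1 i j
      simpa [Matrix.one_apply] using congrFun (congrFun h i.succ) j.succ
    · rintro ⟨rfl, rfl⟩
      exact consMatrix_one
  simp only [Unitary.mem_iff, star_consMatrix, consMatrix_mul, h]
  tauto

/-- The first column has norm one, so the corner entry does. The first row also has norm one, which
leaves nothing for its other entries. -/
theorem exists_eq_consMatrix {B : Matrix (Fin (n + 1)) (Fin (n + 1)) ℍ[ℝ]}
    (hB : B ∈ unitary (Matrix (Fin (n + 1)) (Fin (n + 1)) ℍ[ℝ]))
    (h0 : ∀ i : Fin n, B i.succ 0 = 0) :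
    ∃ (q : SpOne) (A : Sp n), B = consMatrix q A := by
  have h1 : star (B 0 0) * B 0 0 = 1 := by
    have := congrFun (congrFun (Unitary.mem_iff.1 hB).1 0) 0
    simpa [Matrix.mul_apply, Fin.sum_univ_succ, h0, Matrix.star_apply] using this
  have h2 : B 0 0 * star (B 0 0) + ∑ j : Fin n, B 0 j.succ * star (B 0 j.succ) = 1 := by
    have := congrFun (congrFun (Unitary.mem_iff.1 hB).2 0) 0
    simpa [Matrix.mul_apply, Fin.sum_univ_succ, Matrix.star_apply] using this
  have h3 : ∀ j : Fin n, B 0 j.succ = 0 := by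
    rw [Quaternion.star_mul_self, ← Quaternion.coe_one, Quaternion.coe_inj] at h1
    simp only [Quaternion.self_mul_star, h1] at h2
    rw [Quaternion.coe_one, add_eq_left] at h2
    have h4 : ∑ j : Fin n, Quaternion.normSq (B 0 j.succ) = 0 := by
      rw [← coe_sum_quaternion, ← Quaternion.coe_zero, Quaternion.coe_inj] at h2
      exact h2
    intro j
    have := (Finset.sum_eq_zero_iff_of_nonneg fun _ _ => Quaternion.normSq_nonneg).1 h4 j
      (Finset.mem_univ j)
    simpa using this
  have h5 : B = consMatrix (B 0 0) (Matrix.of fun i j => B i.succ j.succ) := by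
    ext1 i j
    refine Fin.cases ?_ (fun i => ?_) i <;> refine Fin.cases ?_ (fun j => ?_) j <;> simp [h0, h3]
  rw [h5, consMatrix_mem_unitary_iff] at hB
  exact ⟨⟨_, hB.1⟩, ⟨_, hB.2⟩, h5⟩

end BlockDiagonal

/-! ### Quaternionic eigenvectors and the maximal torus theorem. -/

theorem stdRep_apply {n : ℕ} (A : Sp n) (v : Fin n × Fin 2 → ℂ) (i : Fin n) (a : Fin 2) :
    stdRep n A v (i, a) =
      ∑ j, ∑ b, quatToMatrix ((A : Matrix (Fin n) (Fin n) ℍ[ℝ]) i j) a b * v (j, b) := by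
  have : stdRep n A v = (Matrix.compRingEquiv (Fin n) (Fin 2) ℂ
    (quatToMatrix.mapMatrix (A : Matrix _ _ ℍ[ℝ]))).mulVec v := rfl
  rw [this, Matrix.mulVec, dotProduct, Fintype.sum_prod_type]
  rfl

theorem character_stdRep {n : ℕ} (A : Sp n) : (stdRep n).character A =
    ((∑ i, 2 * ((A : Matrix (Fin n) (Fin n) ℍ[ℝ]) i i).re : ℝ) : ℂ) := by
  have h : (stdRep n).character A = Matrix.trace (Matrix.compRingEquiv (Fin n) (Fin 2) ℂ
    (quatToMatrix.mapMatrix (A : Matrix _ _ ℍ[ℝ]))) := Matrix.trace_toLin'_eq _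
  rw [h, Matrix.trace, Fintype.sum_prod_type]
  push_cast
  refine Finset.sum_congr rfl fun i _ => ?_
  rw [Fin.sum_univ_two]
  change quatToMatrix _ 0 0 + quatToMatrix _ 1 1 = _
  simp [quatToMatrix, Complex.ext_iff]
  ring

/-- A quaternion is determined by the first column of its complex matrix, which identifies ℍⁿ⁺¹ with
ℂ²ⁿ⁺². A complex eigenvector becomes a right eigenvector, because μ acts on first columns as right
multiplication by a complex number. -/
theorem exists_quaternionic_eigenvector {n : ℕ} (A : Sp (n + 1)) :
    ∃ (w : Fin (n + 1) → ℍ[ℝ]) (c : ℍ[ℝ]), w ≠ 0 ∧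
      ∀ i, ∑ j, (A : Matrix (Fin (n + 1)) (Fin (n + 1)) ℍ[ℝ]) i j * w j = w i * c := by
  obtain ⟨μ, hμ⟩ := Module.End.exists_eigenvalue (stdRep (n + 1) A)
  obtain ⟨v, hv⟩ := hμ.exists_hasEigenvector
  have hcol : ∀ p q : ℍ[ℝ], (∀ a, quatToMatrix p a 0 = quatToMatrix q a 0) → p = q := by
    intro p q h
    have h0 := h 0
    have h1 := h 1
    simp [quatToMatrix, Complex.ext_iff] at h0 h1
    exact Quaternion.ext _ _ h0.1 h0.2 h1.1 h1.2
  let w : Fin (n + 1) → ℍ[ℝ] := fun i =>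
    quat (v (i, 0)).re (v (i, 0)).im (-(v (i, 1)).re) (v (i, 1)).im
  have hw : ∀ i a, quatToMatrix (w i) a 0 = v (i, a) := by
    intro i a
    fin_cases a <;> simp [quatToMatrix, w]
  refine ⟨w, quat μ.re μ.im 0 0, fun h => hv.2 ?_, fun i => hcol _ _ fun a => ?_⟩
  · funext x
    obtain ⟨i, a⟩ := x
    rw [← hw i a, h]
    simp
  · have h1 := congrFun hv.apply_eq_smul (i, a)
    rw [stdRep_apply] at h1
    simp only [map_sum, map_mul, Matrix.sum_apply, Matrix.mul_apply, hw, h1, Pi.smul_apply,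
      smul_eq_mul]
    have h2 : quatToMatrix (quat μ.re μ.im 0 0) 0 0 = μ := by simp [quatToMatrix]
    have h3 : quatToMatrix (quat μ.re μ.im 0 0) 1 0 = 0 := by simp [quatToMatrix, Complex.ext_iff]
    rw [Fin.sum_univ_two, h2, h3, hw, mul_zero, add_zero, mul_comm]

/-- A quaternionic unitary matrix with prescribed first column, by a Householder reflection. -/
theorem exists_unitary_firstColumn {n : ℕ} (w : Fin (n + 1) → ℍ[ℝ]) (r : ℝ) (hr : 0 ≤ r)
    (hw0 : w 0 = ((-r : ℝ) : ℍ[ℝ])) (hw : ∑ i, Quaternion.normSq (w i) = 1) :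
    ∃ Q : Sp (n + 1), ∀ i, (Q : Matrix (Fin (n + 1)) (Fin (n + 1)) ℍ[ℝ]) i 0 = w i := by
  -- The reflection 1 - s v v* in v = w - e₀ takes e₀ to w because w₀ is real. The sign w₀ = -r ≤ 0
  -- keeps |v|² = 2(1 + r) away from zero, and s = 2 / |v|².
  set v : Fin (n + 1) → ℍ[ℝ] := fun i => w i - if i = 0 then 1 else 0 with hv
  have hv0 : v 0 = ((-(1 + r) : ℝ) : ℍ[ℝ]) := by
    simp only [hv, hw0, if_true]
    rw [← Quaternion.coe_one, ← Quaternion.coe_sub]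
    congr 1
    ring
  have hvs : ∀ i : Fin n, v i.succ = w i.succ := fun i => by simp [hv, Fin.succ_ne_zero]
  have hvv : ∑ i, star (v i) * v i = ((2 * (1 + r) : ℝ) : ℍ[ℝ]) := by
    simp only [Quaternion.star_mul_self]
    rw [Fin.sum_univ_succ, hw0] at hw
    rw [Fin.sum_univ_succ, hv0]
    simp only [hvs]
    rw [Quaternion.normSq_coe] at hw ⊢
    have h : ∑ i : Fin n, Quaternion.normSq (w i.succ) = 1 - r ^ 2 := by linarith
    have h' : ∑ i : Fin n, ((Quaternion.normSq (w i.succ) : ℝ) : ℍ[ℝ]) = ((1 - r ^ 2 : ℝ) : ℍ[ℝ]) := by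
      rw [← h, coe_sum_quaternion]
    rw [h', ← Quaternion.coe_add]
    congr 1
    ring
  set s : ℝ := (1 + r)⁻¹ with hs
  have hs1 : s * (1 + r) = 1 := inv_mul_cancel₀ (by positivity)
  set K : Matrix (Fin (n + 1)) (Fin (n + 1)) ℍ[ℝ] := Matrix.of fun i j => v i * star (v j) with hK
  have hKK : K * K = (2 * (1 + r)) • K := by
    ext1 i j
    have h : ∀ k, v i * star (v k) * (v k * star (v j)) = v i * (star (v k) * v k) * star (v j) :=
      fun k => by simp only [mul_assoc]
    simp only [hK, Matrix.mul_apply, Matrix.of_apply, h, Matrix.smul_apply]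
    rw [← Finset.sum_mul, ← Finset.mul_sum, hvv, ← Quaternion.coe_mul_eq_smul,
      ← Quaternion.coe_commutes, mul_assoc]
  have hKs : star K = K := by
    ext1 i j
    simp [hK, Matrix.star_apply]
  have hHH : (1 - s • K) * (1 - s • K) = 1 := by
    rw [sub_mul, mul_sub, mul_sub, smul_mul_smul_comm, hKK, smul_smul]
    simp only [one_mul, mul_one]
    have h : s * s * (2 * (1 + r)) = s + s := by linear_combination (2 * s) * hs1
    rw [h, add_smul]
    abel
  have hHs : star (1 - s • K) = 1 - s • K := by
    have h : star (s • K) = s • star K := by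
      ext1 i j
      simp [Matrix.star_apply]
    rw [star_sub, star_one, h, hKs]
  refine ⟨⟨1 - s • K, by rw [Unitary.mem_iff, hHs, hHH, and_self]⟩, fun i => ?_⟩
  change (1 : Matrix _ _ ℍ[ℝ]) i 0 - s • (v i * star (v 0)) = w i
  rw [hv0, Quaternion.star_coe, ← Quaternion.coe_commutes, Quaternion.coe_mul_eq_smul, smul_smul]
  have h : s * -(1 + r) = -1 := by linarith
  rw [h, hv, Matrix.one_apply]
  simp

/-- The block diagonal element of `Sp(n + 1)` with blocks `q ∈ Sp(1)` and `A ∈ Sp(n)`. -/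
def spCons {n : ℕ} : SpOne × Sp n →* Sp (n + 1) where
  toFun x := ⟨consMatrix x.1 x.2, consMatrix_mem_unitary_iff.2 ⟨x.1.2, x.2.2⟩⟩
  map_one' := Subtype.ext consMatrix_one
  map_mul' _ _ := Subtype.ext (consMatrix_mul _ _ _ _).symm

/-- The diagonal element of `Sp(n)` with given entries. -/
def spDiag {n : ℕ} (u : Fin n → SpOne) : Sp n :=
  ⟨Matrix.diagonal fun i => (u i : ℍ[ℝ]), by
    rw [Unitary.mem_iff, Matrix.star_eq_conjTranspose, Matrix.diagonal_conjTranspose,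
      Matrix.diagonal_mul_diagonal, Matrix.diagonal_mul_diagonal, ← Matrix.diagonal_one]
    have h := fun i => Unitary.mem_iff.1 (u i).2
    exact ⟨congrArg _ (funext fun i => (h i).1), congrArg _ (funext fun i => (h i).2)⟩⟩

/-- The diagonal element of `Sp(n)` with entries on the upper half circle and real parts `x`. -/
def spDiagonal {n : ℕ} (x : Fin n → ℝ) : Sp n :=
  spDiag fun i => torus (Real.arccos (x i))

theorem spCons_spDiagonal {n : ℕ} (t : ℝ) (x : Fin n → ℝ) :
    spCons (torus (Real.arccos t), spDiagonal x) = spDiagonal (Fin.cons t x : Fin (n + 1) → ℝ) := by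
  apply Subtype.ext
  change consMatrix _ (Matrix.diagonal _) = Matrix.diagonal _
  ext1 i j
  refine Fin.cases ?_ (fun i => ?_) i <;> refine Fin.cases ?_ (fun j => ?_) j <;>
    simp [Matrix.diagonal_apply, Fin.succ_ne_zero, (Fin.succ_ne_zero _).symm]

/-- Right multiplication of an eigenvector by a nonzero quaternion only conjugates the eigenvalue.
This freedom makes the first coordinate real and nonpositive, as the Householder reflection
requires. -/
theorem exists_unit_eigenvector {n : ℕ} (A : Sp (n + 1)) :
    ∃ (w : Fin (n + 1) → ℍ[ℝ]) (e : ℍ[ℝ]) (r : ℝ), 0 ≤ r ∧ w 0 = ((-r : ℝ) : ℍ[ℝ]) ∧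
      ∑ i, Quaternion.normSq (w i) = 1 ∧
      ∀ i, ∑ j, (A : Matrix (Fin (n + 1)) (Fin (n + 1)) ℍ[ℝ]) i j * w j = w i * e := by
  obtain ⟨w, c, hw, hA⟩ := exists_quaternionic_eigenvector A
  obtain ⟨d, hd, r, hr, hwd⟩ : ∃ d : ℍ[ℝ], d ≠ 0 ∧ ∃ r : ℝ, 0 ≤ r ∧
      w 0 * d = ((-r : ℝ) : ℍ[ℝ]) := by
    by_cases h0 : w 0 = 0
    · exact ⟨1, one_ne_zero, 0, le_rfl, by simp [h0]⟩
    · refine ⟨-star (w 0), neg_ne_zero.2 (star_ne_zero.2 h0), _, Quaternion.normSq_nonneg (a := w 0),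
        ?_⟩
      rw [mul_neg, Quaternion.self_mul_star, Quaternion.coe_neg]
  have hNpos : 0 < ∑ i, Quaternion.normSq (w i * d) := by
    obtain ⟨i, hi⟩ := Function.ne_iff.1 hw
    refine Finset.sum_pos' (fun _ _ => Quaternion.normSq_nonneg) ⟨i, Finset.mem_univ i, ?_⟩
    refine lt_of_le_of_ne Quaternion.normSq_nonneg (Ne.symm ?_)
    rw [Quaternion.normSq_ne_zero]
    exact mul_ne_zero hi hd
  generalize hN : ∑ i, Quaternion.normSq (w i * d) = N at hNpos
  obtain ⟨s, hspos, hs2⟩ : ∃ s : ℝ, 0 < s ∧ s ^ 2 * N = 1 := by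
    refine ⟨(√N)⁻¹, inv_pos.2 (Real.sqrt_pos.2 hNpos), ?_⟩
    rw [inv_pow, Real.sq_sqrt hNpos.le, inv_mul_cancel₀ hNpos.ne']
  have hsd : s • d ≠ 0 := smul_ne_zero hspos.ne' hd
  refine ⟨fun i => w i * (s • d), (s • d)⁻¹ * (c * (s • d)), s * r, by positivity, ?_, ?_, ?_⟩
  · beta_reduce
    rw [mul_smul_comm, hwd, ← Quaternion.coe_mul_eq_smul, ← Quaternion.coe_mul]
    congr 1
    ring
  · simp only [mul_smul_comm, Quaternion.normSq_smul]
    rw [← Finset.mul_sum, hN, hs2]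
  · intro i
    simp only [← mul_assoc]
    rw [← Finset.sum_mul, hA, mul_inv_cancel_right₀ hsd]

/-- Every element of `Sp(n + 1)` is conjugate to a block diagonal element. -/
theorem exists_conj_spCons {n : ℕ} (A : Sp (n + 1)) :
    ∃ (Q : Sp (n + 1)) (q : SpOne) (A' : Sp n), A = Q * spCons (q, A') * Q⁻¹ := by
  obtain ⟨w, e, r, hr, hw0, hw, hA⟩ := exists_unit_eigenvector A
  obtain ⟨Q, hQ⟩ := exists_unitary_firstColumn w r hr hw0 hw
  have hcol : ∀ i, ((A : Matrix (Fin (n + 1)) (Fin (n + 1)) ℍ[ℝ]) * Q.1) i 0 = Q.1 i 0 * e := by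
    intro i
    rw [Matrix.mul_apply]
    simp only [hQ]
    exact hA i
  have hB : ∀ i : Fin n, (star Q.1 * (A.1 * Q.1)) i.succ 0 = 0 := by
    intro i
    have h1 : (star Q.1 * Q.1) i.succ 0 = 0 := by
      rw [(Unitary.mem_iff.1 Q.2).1]
      simp [Fin.succ_ne_zero]
    rw [Matrix.mul_apply] at h1 ⊢
    simp only [hcol, ← mul_assoc]
    rw [← Finset.sum_mul, h1, zero_mul]
  obtain ⟨q, A', h⟩ := exists_eq_consMatrix
    (mul_mem (Unitary.star_mem Q.2) (mul_mem A.2 Q.2)) hB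
  refine ⟨Q, q, A', ?_⟩
  have h' : Q⁻¹ * (A * Q) = spCons (q, A') := Subtype.ext h
  rw [← h']
  group

/-- The maximal torus theorem for `Sp(n)`. -/
theorem exists_conj_spDiagonal {n : ℕ} (A : Sp n) :
    ∃ (P : Sp n) (x : Fin n → ℝ), (∀ i, |x i| ≤ 1) ∧ A = P * spDiagonal x * P⁻¹ := by
  induction n with
  | zero => exact ⟨1, 0, fun i => i.elim0, Subtype.ext (Matrix.ext fun i => i.elim0)⟩
  | succ n ih =>
    obtain ⟨Q, q, A', rfl⟩ := exists_conj_spCons A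
    obtain ⟨P, x, hx, rfl⟩ := ih A'
    obtain ⟨u, hu⟩ := exists_conj_torus q
    refine ⟨Q * spCons (u, P), Fin.cons (q : ℍ[ℝ]).re x, ?_, ?_⟩
    · intro i
      refine Fin.cases ?_ (fun i => ?_) i
      · exact abs_re_spOne_le q
      · exact hx i
    · have h : (q, P * spDiagonal x * P⁻¹) =
          (u, P) * (torus (Real.arccos (q : ℍ[ℝ]).re), spDiagonal x) * (u, P)⁻¹ :=
        Prod.ext hu rfl
      rw [h, map_mul, map_mul, map_inv, spCons_spDiagonal]
      group

/-! ### Conjugacy classes and the centre of Sp(3). -/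

theorem character_stdRep_conj {n : ℕ} (P A : Sp n) :
    (stdRep n).character (P * A * P⁻¹) = (stdRep n).character A :=
  Representation.char_conj _ _ _

theorem re_sq_spOne (u : SpOne) :
    ((u ^ 2 : SpOne) : ℍ[ℝ]).re = 2 * (u : ℍ[ℝ]).re ^ 2 - 1 := by
  have := u.sq_add_sq
  rw [SubmonoidClass.coe_pow, pow_two, Quaternion.re_mul]
  linarith

theorem re_cube_spOne (u : SpOne) :
    ((u ^ 3 : SpOne) : ℍ[ℝ]).re = 4 * (u : ℍ[ℝ]).re ^ 3 - 3 * (u : ℍ[ℝ]).re := by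
  have := u.sq_add_sq
  rw [SubmonoidClass.coe_pow, pow_succ, pow_two]
  simp only [Quaternion.re_mul, Quaternion.imI_mul, Quaternion.imJ_mul, Quaternion.imK_mul]
  linear_combination (-3 * (u : ℍ[ℝ]).re) * this

theorem re_torus_arccos {x : ℝ} (hx : |x| ≤ 1) : (torus (Real.arccos x) : ℍ[ℝ]).re = x :=
  Real.cos_arccos (abs_le.1 hx).1 (abs_le.1 hx).2

theorem coe_spDiagonal_pow {n : ℕ} (x : Fin n → ℝ) (m : ℕ) :
    ((spDiagonal x ^ m : Sp n) : Matrix (Fin n) (Fin n) ℍ[ℝ]) =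
      Matrix.diagonal fun i => ((torus (Real.arccos (x i)) ^ m : SpOne) : ℍ[ℝ]) := by
  rw [SubmonoidClass.coe_pow]
  exact Matrix.diagonal_pow _ _

theorem character_spDiagonal_pow {n : ℕ} (x : Fin n → ℝ) (m : ℕ) :
    (stdRep n).character (spDiagonal x ^ m) =
      ((∑ i, 2 * ((torus (Real.arccos (x i)) ^ m : SpOne) : ℍ[ℝ]).re : ℝ) : ℂ) := by
  rw [character_stdRep, coe_spDiagonal_pow]
  simp

/-- The permutation matrices in `Sp(n)`. -/
def spPerm {n : ℕ} (σ : Equiv.Perm (Fin n)) : Sp n :=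
  ⟨(1 : Matrix (Fin n) (Fin n) ℍ[ℝ]).submatrix σ id, by
    rw [Unitary.mem_iff, Matrix.star_eq_conjTranspose, Matrix.conjTranspose_submatrix,
      Matrix.conjTranspose_one]
    constructor
    · rw [← Matrix.submatrix_mul 1 1 id σ id σ.bijective, mul_one,
        Matrix.submatrix_one id Function.injective_id]
    · rw [← Matrix.submatrix_mul 1 1 σ id σ Function.bijective_id, mul_one,
        Matrix.submatrix_one σ σ.injective]⟩

theorem coe_spPerm_apply {n : ℕ} (σ : Equiv.Perm (Fin n)) (i j : Fin n) :
    (spPerm σ : Matrix (Fin n) (Fin n) ℍ[ℝ]) i j = if σ i = j then 1 else 0 := by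
  simp [spPerm, Matrix.one_apply]

theorem exists_conj_spDiagonal_comp {n : ℕ} (x : Fin n → ℝ) (σ : Equiv.Perm (Fin n)) :
    ∃ P : Sp n, spDiagonal (x ∘ σ) = P * spDiagonal x * P⁻¹ := by
  refine ⟨spPerm σ, ?_⟩
  rw [eq_mul_inv_iff_mul_eq]
  apply Subtype.ext
  change Matrix.diagonal _ * (spPerm σ).1 = (spPerm σ).1 * Matrix.diagonal _
  ext1 i j
  simp only [Matrix.diagonal_mul, Matrix.mul_diagonal, coe_spPerm_apply, Function.comp]
  split_ifs with h
  · rw [h, mul_one, one_mul]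
  · rw [mul_zero, zero_mul]

/-- By Newton's identities the elementary symmetric functions agree, so x₀ is a root of the cubic
with roots yᵢ. Removing it leaves a quadratic. -/
theorem exists_perm_of_power_sums {x y : Fin 3 → ℝ} (h1 : ∑ i, x i = ∑ i, y i)
    (h2 : ∑ i, x i ^ 2 = ∑ i, y i ^ 2) (h3 : ∑ i, x i ^ 3 = ∑ i, y i ^ 3) :
    ∃ σ : Equiv.Perm (Fin 3), x = y ∘ σ := by
  simp only [Fin.sum_univ_three] at h1 h2 h3
  have e2 : x 0 * x 1 + x 0 * x 2 + x 1 * x 2 = y 0 * y 1 + y 0 * y 2 + y 1 * y 2 := by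
    linear_combination (x 0 + x 1 + x 2 + y 0 + y 1 + y 2) / 2 * h1 - h2 / 2
  have e3 : x 0 * x 1 * x 2 = y 0 * y 1 * y 2 := by
    linear_combination h3 / 3 - (x 0 ^ 2 + x 1 ^ 2 + x 2 ^ 2 -
      (x 0 * x 1 + x 0 * x 2 + x 1 * x 2)) / 3 * h1 - (y 0 + y 1 + y 2) / 3 * (h2 - e2)
  have key : ∀ a b c : Fin 3, Function.Bijective ![a, b, c] → x 0 = y a → x 1 = y b → x 2 = y c →
      ∃ σ : Equiv.Perm (Fin 3), x = y ∘ σ := by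
    intro a b c hσ h0 h1 h2
    refine ⟨Equiv.ofBijective _ hσ, funext fun i => ?_⟩
    fin_cases i
    exacts [h0, h1, h2]
  have two : ∀ a b c d : ℝ, a + b = c + d → a * b = c * d → a = c ∧ b = d ∨ a = d ∧ b = c := by
    intro a b c d hs hp
    have h : (a - c) * (a - d) = 0 := by linear_combination a * hs - hp
    rcases mul_eq_zero.1 h with h | h
    · exact Or.inl ⟨by linarith, by linarith⟩
    · exact Or.inr ⟨by linarith, by linarith⟩
  have three : (x 0 - y 0) * (x 0 - y 1) * (x 0 - y 2) = 0 := by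
    linear_combination x 0 ^ 2 * h1 - x 0 * e2 + e3
  have rest : ∀ a b c : ℝ, x 0 = a → a + b + c = y 0 + y 1 + y 2 →
      a * b + a * c + b * c = y 0 * y 1 + y 0 * y 2 + y 1 * y 2 →
      x 1 = b ∧ x 2 = c ∨ x 1 = c ∧ x 2 = b := by
    rintro a b c rfl hs hp
    apply two
    · linarith
    · linear_combination e2 - hp - x 0 * (h1 - hs)
  rcases mul_eq_zero.1 three with h | h
  · rcases mul_eq_zero.1 h with h | h
    · rcases rest (y 0) (y 1) (y 2) (by linarith) (by ring) (by ring) with h' | h'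
      · exact key 0 1 2 (by decide) (by linarith) h'.1 h'.2
      · exact key 0 2 1 (by decide) (by linarith) h'.1 h'.2
    · rcases rest (y 1) (y 0) (y 2) (by linarith) (by ring) (by ring) with h' | h'
      · exact key 1 0 2 (by decide) (by linarith) h'.1 h'.2
      · exact key 1 2 0 (by decide) (by linarith) h'.1 h'.2
  · rcases rest (y 2) (y 0) (y 1) (by linarith) (by ring) (by ring) with h' | h'
    · exact key 2 0 1 (by decide) (by linarith) h'.1 h'.2
    · exact key 2 1 0 (by decide) (by linarith) h'.1 h'.2

/-- For diagonal entries with real parts cos θᵢ the three traces give the sums of cos θᵢ, cos 2θᵢ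
and cos 3θᵢ, hence the first three power sums of the cos θᵢ. Permutation matrices realize any
reordering. -/
theorem exists_conj_of_character_pow_eq {A B : Sp 3}
    (h : ∀ m ∈ Finset.Icc 1 3, (stdRep 3).character (A ^ m) = (stdRep 3).character (B ^ m)) :
    ∃ P, A = P * B * P⁻¹ := by
  obtain ⟨P, x, hx, rfl⟩ := exists_conj_spDiagonal A
  obtain ⟨Q, y, hy, rfl⟩ := exists_conj_spDiagonal B
  simp only [conj_pow, character_stdRep_conj, character_spDiagonal_pow, Complex.ofReal_inj,
    ← Finset.mul_sum] at h
  have h1 := h 1 (by simp)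
  have h2 := h 2 (by simp)
  have h3 := h 3 (by simp)
  simp only [pow_one, re_sq_spOne, re_cube_spOne, re_torus_arccos (hx _), re_torus_arccos (hy _),
    Fin.sum_univ_three] at h1 h2 h3
  obtain ⟨σ, rfl⟩ := exists_perm_of_power_sums (x := x) (y := y)
    (by simp only [Fin.sum_univ_three]; linarith)
    (by simp only [Fin.sum_univ_three]; linarith) (by simp only [Fin.sum_univ_three]; linarith)
  obtain ⟨R, hR⟩ := exists_conj_spDiagonal_comp y σ
  refine ⟨P * R * Q⁻¹, ?_⟩
  rw [hR]
  group

theorem eq_one_of_character_eq_six {A : Sp 3} (h : (stdRep 3).character A = 6) : A = 1 := by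
  obtain ⟨P, x, hx, rfl⟩ := exists_conj_spDiagonal A
  rw [character_stdRep_conj, ← pow_one (spDiagonal x), character_spDiagonal_pow] at h
  have h' : ∑ i, 2 * ((torus (Real.arccos (x i)) ^ 1 : SpOne) : ℍ[ℝ]).re = 6 := by
    exact_mod_cast h
  simp only [pow_one, re_torus_arccos (hx _), Fin.sum_univ_three] at h'
  have h0 := (abs_le.1 (hx 0)).2
  have h1 := (abs_le.1 (hx 1)).2
  have h2 := (abs_le.1 (hx 2)).2
  have hx1 : ∀ i, x i = 1 := by
    intro i
    fin_cases i <;> simp <;> linarith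
  have hd : spDiagonal x = 1 := by
    apply Subtype.ext
    change Matrix.diagonal _ = 1
    rw [← Matrix.diagonal_one]
    congr 1
    funext i
    beta_reduce
    rw [hx1 i, Real.arccos_one]
    apply Quaternion.ext <;> simp
  rw [hd, mul_one, mul_inv_cancel]

/-- Commuting with diagonal sign changes removes the off-diagonal entries, commuting with scalar i
and j makes the diagonal real, and commuting with transpositions makes it constant. -/
theorem character_eq_of_central {A : Sp 3} (hA : ∀ B, A * B = B * A) :
    (stdRep 3).character A = 6 ∨ (stdRep 3).character A = -6 := by
  have hmul : ∀ (u : Fin 3 → SpOne) i j, A.1 i j * u j = u i * A.1 i j := by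
    intro u i j
    have h : ((A : Matrix (Fin 3) (Fin 3) ℍ[ℝ]) * Matrix.diagonal fun i => (u i : ℍ[ℝ])) i j =
        ((Matrix.diagonal fun i => (u i : ℍ[ℝ])) * (A : Matrix (Fin 3) (Fin 3) ℍ[ℝ])) i j :=
      congrFun (congrFun (congrArg Subtype.val (hA (spDiag u))) i) j
    rwa [Matrix.mul_diagonal, Matrix.diagonal_mul] at h
  have hoff : ∀ i j, i ≠ j → A.1 i j = 0 := by
    intro i j hij
    have h := hmul (Function.update 1 i (-1)) i j
    rw [Function.update_of_ne hij.symm, Function.update_self] at h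
    have h' : A.1 i j = -A.1 i j := by simpa [Unitary.coe_neg] using h
    have h2 : (2 : ℝ) • A.1 i j = 0 := by rw [two_smul, ← sub_neg_eq_add, ← h', sub_self]
    exact (smul_eq_zero.1 h2).resolve_left two_ne_zero
  have hreal : ∀ i, A.1 i i = ((A.1 i i).re : ℍ[ℝ]) := by
    intro i
    have h1 := hmul (fun _ => ⟨quat 0 1 0 0, mem_unitary_quaternion_iff.2 (by simp)⟩) i i
    have h2 := hmul (fun _ => ⟨quat 0 0 1 0, mem_unitary_quaternion_iff.2 (by simp)⟩) i i
    have a1 := congrArg (fun q : ℍ[ℝ] => q.imK) h1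
    have a2 := congrArg (fun q : ℍ[ℝ] => q.imJ) h1
    have a3 := congrArg (fun q : ℍ[ℝ] => q.imK) h2
    simp at a1 a2 a3
    apply Quaternion.ext <;> simp <;> linarith
  have heq : ∀ i, A.1 i i = A.1 0 0 := by
    intro i
    have h : ((A : Matrix (Fin 3) (Fin 3) ℍ[ℝ]) * (spPerm (Equiv.swap 0 i)).1) 0 i =
        ((spPerm (Equiv.swap 0 i)).1 * (A : Matrix (Fin 3) (Fin 3) ℍ[ℝ])) 0 i :=
      congrFun (congrFun (congrArg Subtype.val (hA (spPerm (Equiv.swap 0 i)))) 0) i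
    rw [Matrix.mul_apply, Matrix.mul_apply, Finset.sum_eq_single 0, Finset.sum_eq_single i] at h
    · simpa [coe_spPerm_apply] using h.symm
    · intro j _ hj
      rw [hoff j i hj, mul_zero]
    · simp
    · intro j _ hj
      rw [hoff 0 j hj.symm, zero_mul]
    · simp
  have hone : (A.1 0 0).re * (A.1 0 0).re = 1 := by
    have h := congrFun (congrFun (Unitary.mem_iff.1 A.2).1 0) 0
    rw [Matrix.mul_apply, Finset.sum_eq_single 0, Matrix.star_apply, hreal 0] at h
    · rw [Quaternion.star_coe, ← Quaternion.coe_mul, Matrix.one_apply_eq, ← Quaternion.coe_one,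
        Quaternion.coe_inj] at h
      exact h
    · intro j _ hj
      rw [hoff j 0 hj, mul_zero]
    · simp
  rw [character_stdRep, Fin.sum_univ_three]
  change ((2 * (A.1 0 0).re + 2 * (A.1 1 1).re + 2 * (A.1 2 2).re : ℝ) : ℂ) = 6 ∨
    ((2 * (A.1 0 0).re + 2 * (A.1 1 1).re + 2 * (A.1 2 2).re : ℝ) : ℂ) = -6
  rw [heq 1, heq 2]
  rcases mul_self_eq_one_iff.1 hone with h | h <;> rw [h] <;> norm_num

/-! ### Quaternionic structures and parity of the invariants. -/

theorem isContinuousRep_stdRep_comp {n : ℕ} {f : SpOne →* Sp n} (hf : Continuous f) :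
    IsContinuousRep ((stdRep n).comp f) := by
  intro φ v
  refine φ.continuous_of_finiteDimensional.comp (continuous_pi fun x => ?_)
  obtain ⟨i, a⟩ := x
  have h : ∀ g, ((stdRep n).comp f) g v (i, a) = _ := fun g => stdRep_apply (f g) v i a
  simp only [h]
  refine continuous_finsetSum _ fun j _ => continuous_finsetSum _ fun b _ =>
    Continuous.mul ?_ continuous_const
  have h1 : Continuous fun g => (f g : Matrix (Fin n) (Fin n) ℍ[ℝ]) i j :=
    (continuous_subtype_val.comp hf).matrix_elem i j
  exact (continuous_quatToMatrix.comp h1).matrix_elem a b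

/-- A complex vector space with a quaternionic structure has even dimension. -/
theorem even_finrank_of_quaternionic {W : Type*} [AddCommGroup W] [Module ℂ W]
    [FiniteDimensional ℂ W] (J : W →ₛₗ[starRingEnd ℂ] W) (hJ : ∀ w, J (J w) = -w) :
    Even (Module.finrank ℂ W) := by
  let b := Module.finBasis ℂ W
  let M : Matrix (Fin (Module.finrank ℂ W)) (Fin (Module.finrank ℂ W)) ℂ :=
    Matrix.of fun i j => b.repr (J (b j)) i
  -- J² = -1 in coordinates. Determinants then give |det M|² = (-1)^(dim W), so the dimension cannot
  -- be odd.
  have hM : M * (starRingEnd ℂ).mapMatrix M = -1 := by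
    ext k j
    have h : J (J (b j)) = ∑ i, starRingEnd ℂ (M i j) • J (b i) := by
      conv_lhs => rw [← b.sum_repr (J (b j))]
      rw [map_sum]
      exact Finset.sum_congr rfl fun i _ => J.map_smulₛₗ _ _
    rw [hJ] at h
    have h' := congrArg (fun w => b.repr w k) h
    simp only [map_neg, Module.Basis.repr_self, map_sum, map_smul, Finsupp.coe_neg, Pi.neg_apply,
      Finsupp.coe_finsetSum, Finset.sum_apply, Finsupp.smul_apply, smul_eq_mul] at h'
    rw [Matrix.mul_apply, Matrix.neg_apply, Matrix.one_apply]
    simp only [Finsupp.single_apply, eq_comm (a := j)] at h'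
    rw [h']
    exact Finset.sum_congr rfl fun i _ => mul_comm _ _
  have hdet := congrArg Matrix.det hM
  rw [Matrix.det_mul, ← RingHom.map_det, Complex.mul_conj, Matrix.det_neg, Matrix.det_one, mul_one,
    Fintype.card_fin] at hdet
  by_contra hodd
  rw [Nat.not_even_iff_odd] at hodd
  rw [hodd.neg_one_pow] at hdet
  have h1 : Complex.normSq M.det = -1 := by exact_mod_cast hdet
  have h2 := Complex.normSq_nonneg M.det
  linarith

/-- The quaternionic structure on `ℂ²ⁿ`, given by right multiplication by `j` on `ℍⁿ`. -/
def quaternionicStructure (n : ℕ) : (Fin n × Fin 2 → ℂ) →ₛₗ[starRingEnd ℂ] (Fin n × Fin 2 → ℂ) where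
  toFun v x := if x.2 = 0 then starRingEnd ℂ (v (x.1, 1)) else -starRingEnd ℂ (v (x.1, 0))
  map_add' v w := by
    funext x
    simp only [Pi.add_apply, map_add]
    split_ifs <;> ring
  map_smul' c v := by
    funext x
    simp only [Pi.smul_apply, smul_eq_mul, map_mul]
    split_ifs <;> ring

theorem quaternionicStructure_stdRep {n : ℕ} (A : Sp n) (v : Fin n × Fin 2 → ℂ) :
    quaternionicStructure n (stdRep n A v) = stdRep n A (quaternionicStructure n v) := by
  funext x
  obtain ⟨i, a⟩ := x
  rw [stdRep_apply]
  simp only [quaternionicStructure, LinearMap.coe_mk, AddHom.coe_mk, stdRep_apply]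
  split_ifs with h
  · rw [h, map_sum]
    refine Finset.sum_congr rfl fun j _ => ?_
    simp [Fin.sum_univ_two, quatToMatrix, Complex.ext_iff]
    constructor <;> ring
  · have ha : a = 1 := by omega
    rw [ha, map_sum, ← Finset.sum_neg_distrib]
    refine Finset.sum_congr rfl fun j _ => ?_
    simp [Fin.sum_univ_two, quatToMatrix, Complex.ext_iff]
    constructor <;> ring

theorem even_finrank_invariants_stdRep_comp {G : Type*} [Group G] {n : ℕ} (f : G →* Sp n) :
    Even (Module.finrank ℂ (Representation.invariants ((stdRep n).comp f))) := by
  let J := quaternionicStructure n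
  have hJ : ∀ v ∈ Representation.invariants ((stdRep n).comp f),
      J v ∈ Representation.invariants ((stdRep n).comp f) := by
    intro v hv g
    exact (quaternionicStructure_stdRep (f g) v).symm.trans (congrArg J (hv g))
  refine even_finrank_of_quaternionic
    { toFun := fun v => ⟨J v, hJ v v.2⟩
      map_add' := fun v w => Subtype.ext (J.map_add _ _)
      map_smul' := fun c v => Subtype.ext (J.map_smulₛₗ _ _) } fun v => Subtype.ext ?_
  funext x
  obtain ⟨i, a⟩ := x
  fin_cases a <;> simp [J, quaternionicStructure]

/-! ### Classification of homomorphisms Sp(1) → Sp(3). -/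

/-- The character of `φ_{k₁} + ⋯ + φ_{k_m}` at the elements of complex trace `x`. -/
def listChar (l : List ℕ) (x : ℝ) : ℝ := (l.map fun k => phiChar k x).sum

theorem IsEquivalentTo.character {f : SpOne →* Sp 3} {l : List ℕ} (h : IsEquivalentTo f l)
    (u : SpOne) : (stdRep 3).character (f u) = (listChar l (2 * (u : ℍ[ℝ]).re) : ℂ) := by
  obtain ⟨e⟩ := h
  exact (congrFun (Representation.char_iso (e.trans (phiSumEquivPhiPi l))) u).trans
    ((character_phiPi l u).trans (by simp [listChar]))

@[simp] theorem phiChar_two (x : ℝ) : phiChar 2 x = x ^ 2 - 1 := by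
  have := mul_phiChar_succ 0 x
  simp at this
  linarith

@[simp] theorem phiChar_three (x : ℝ) : phiChar 3 x = x ^ 3 - 2 * x := by
  have := mul_phiChar_succ 1 x
  simp at this
  linarith

@[simp] theorem phiChar_five (x : ℝ) : phiChar 5 x = x ^ 5 - 4 * x ^ 3 + 3 * x := by
  have h2 := mul_phiChar_succ 2 x
  have h3 := mul_phiChar_succ 3 x
  simp at h2 h3
  have h4 : phiChar 4 x = x * (x ^ 3 - 2 * x) - (x ^ 2 - 1) := by linarith
  rw [h4] at h3
  linarith

/-- The nontrivial six-dimensional symplectic representations of `Sp(1)`. -/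
def symplecticTypes : List (List ℕ) :=
  [[0, 0, 0, 0, 1], [0, 0, 1, 1], [1, 1, 1], [1, 3], [5], [2, 2], [0, 0, 3]]

/-- In a symplectic representation every φ_{2i} has even multiplicity, but in dimension six the case
i = 0 is enough: a single φ_2 or φ_4 leaves an odd dimension, which takes an odd number of φ_0 to
fill. -/
theorem perm_symplecticTypes_of_sum_eq_six {l : List ℕ} (hl : (l.map (· + 1)).sum = 6)
    (h0 : Even (l.count 0)) :
    l.Perm [0, 0, 0, 0, 0, 0] ∨ ∃ l' ∈ symplecticTypes, l.Perm l' := by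
  have hle : ∀ k ∈ l, k < 6 := by
    intro k hk
    have := List.le_sum_of_mem (List.mem_map_of_mem (f := (· + 1)) hk)
    omega
  have hperm : ∀ l' : List ℕ, (∀ k ∈ l', k < 6) → (∀ k < 6, l.count k = l'.count k) →
      l.Perm l' := by
    intro l' hl' h
    rw [List.perm_iff_count]
    intro k
    by_cases hk : k < 6
    · exact h k hk
    · rw [List.count_eq_zero.2 fun h => hk (hle k h), List.count_eq_zero.2 fun h => hk (hl' k h)]
  have hsum : ∑ k ∈ Finset.range 6, l.count k * (k + 1) = 6 := by
    have h := Finset.sum_list_map_count l (· + 1)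
    rw [hl] at h
    refine Eq.trans (Eq.symm ?_) h.symm
    simp only [smul_eq_mul]
    refine Finset.sum_subset (fun k hk => Finset.mem_range.2 (hle k (List.mem_toFinset.1 hk))) ?_
    intro k _ hk
    rw [List.count_eq_zero.2 fun h => hk (List.mem_toFinset.2 h), zero_mul]
  simp only [Finset.sum_range_succ, Finset.sum_range_zero] at hsum
  obtain ⟨m, hm⟩ := h0
  have key : ∀ l' : List ℕ, (∀ k ∈ l', k < 6) → l.count 0 = l'.count 0 → l.count 1 = l'.count 1 →
      l.count 2 = l'.count 2 → l.count 3 = l'.count 3 → l.count 4 = l'.count 4 →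
      l.count 5 = l'.count 5 → l.Perm l' := by
    intro l' hl' h0 h1 h2 h3 h4 h5
    refine hperm l' hl' fun k hk => ?_
    interval_cases k <;> assumption
  generalize l.count 0 = m0 at *
  generalize l.count 1 = m1 at *
  generalize l.count 2 = m2 at *
  generalize l.count 3 = m3 at *
  generalize l.count 4 = m4 at *
  generalize l.count 5 = m5 at *
  have b1 : m1 ≤ 3 := by omega
  have b2 : m2 ≤ 2 := by omega
  have b3 : m3 ≤ 1 := by omega
  have b4 : m4 = 0 := by omega
  have b5 : m5 ≤ 1 := by omega
  have b : m ≤ 3 := by omega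
  subst b4
  subst hm
  simp only [symplecticTypes, List.mem_cons, List.not_mem_nil, or_false, exists_eq_or_imp,
    exists_eq_left]
  interval_cases m5 <;> interval_cases m3 <;> interval_cases m2 <;> interval_cases m1 <;>
    interval_cases m <;> first
      | (exfalso; omega)
      | (refine Or.inl (key _ ?_ ?_ ?_ ?_ ?_ ?_ ?_) <;> decide)
      | (refine Or.inr (Or.inl (key _ ?_ ?_ ?_ ?_ ?_ ?_ ?_)) <;> decide)
      | (refine Or.inr (Or.inr (Or.inl (key _ ?_ ?_ ?_ ?_ ?_ ?_ ?_))) <;> decide)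
      | (refine Or.inr (Or.inr (Or.inr (Or.inl (key _ ?_ ?_ ?_ ?_ ?_ ?_ ?_)))) <;> decide)
      | (refine Or.inr (Or.inr (Or.inr (Or.inr (Or.inl (key _ ?_ ?_ ?_ ?_ ?_ ?_ ?_))))) <;> decide)
      | (refine Or.inr (Or.inr (Or.inr (Or.inr (Or.inr (Or.inl
          (key _ ?_ ?_ ?_ ?_ ?_ ?_ ?_)))))) <;> decide)
      | (refine Or.inr (Or.inr (Or.inr (Or.inr (Or.inr (Or.inr (Or.inl
          (key _ ?_ ?_ ?_ ?_ ?_ ?_ ?_))))))) <;> decide)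
      | (refine Or.inr (Or.inr (Or.inr (Or.inr (Or.inr (Or.inr (Or.inr
          (key _ ?_ ?_ ?_ ?_ ?_ ?_ ?_))))))) <;> decide)

/-- The classification of the continuous nontrivial homomorphisms `Sp(1) → Sp(3)`. -/
theorem exists_isEquivalentTo {f : SpOne →* Sp 3} (hf : Continuous f) (hne : f ≠ 1) :
    ∃ l ∈ symplecticTypes, IsEquivalentTo f l := by
  obtain ⟨l, ⟨e⟩⟩ := exists_equiv_phiPi (isContinuousRep_stdRep_comp hf)
  have hdim : (l.map (· + 1)).sum = 6 := by
    rw [← finrank_phiPi, ← e.toLinearEquiv.finrank_eq, Module.finrank_fintype_fun_eq_card]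
    simp
  have heven : Even (l.count 0) := by
    rw [← finrank_invariants_phiPi, ← RepresentationEquiv.finrank_invariants_eq e]
    exact even_finrank_invariants_stdRep_comp f
  have hperm : ∀ l', l.Perm l' → IsEquivalentTo f l' := by
    intro l' h
    obtain ⟨e'⟩ := phiPi_equiv_of_perm h
    exact ⟨e.trans (e'.trans (phiSumEquivPhiPi l').symm)⟩
  rcases perm_symplecticTypes_of_sum_eq_six hdim heven with h | ⟨l', hl', h⟩
  · refine absurd (MonoidHom.ext fun u => ?_) hne
    apply eq_one_of_character_eq_six
    rw [(hperm _ h).character]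
    simp [listChar]
    norm_num
  · exact ⟨l', hl', hperm l' h⟩

/-! ### Comparing the characters of pairs of types. -/

theorem eq_two_of_mem_pairTable {r : List ℕ × List ℕ} (hr : r ∈ pairTable) {x : ℝ}
    (h1 : listChar r.1 x = listChar r.2 x)
    (h2 : listChar r.1 (x ^ 2 - 2) = listChar r.2 (x ^ 2 - 2)) : x = 2 := by
  simp only [pairTable, List.mem_cons, List.not_mem_nil, or_false] at hr
  -- In six cases `h1` alone has 2 as its only real root. The pairs involving 2φ_2, and the pair
  -- (3φ_1, 2φ_0 + φ_3), have further roots, which `h2` rules out.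
  rcases hr with rfl | rfl | rfl | rfl | rfl | rfl | rfl | rfl | rfl | rfl <;>
    simp [listChar] at h1 h2
  · linarith
  · linarith
  · have h : (x - 2) * (x ^ 2 + 2 * x + 2) = 0 := by linear_combination -h1
    rcases mul_eq_zero.1 h with h | h <;> nlinarith [sq_nonneg (x + 1)]
  · have h : (x - 2) * (x ^ 4 + 2 * x ^ 3 + 2) = 0 := by linear_combination -h1
    rcases mul_eq_zero.1 h with h | h
    · linarith
    · have h' : (x ^ 2 + x - 1) ^ 2 + (x + 1) ^ 2 = 0 := by linear_combination h
      have h3 : x + 1 = 0 := by nlinarith [sq_nonneg (x ^ 2 + x - 1), sq_nonneg (x + 1)]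
      have h4 : x = -1 := by linarith
      rw [h4] at h'
      norm_num at h'
  · have h : (x - 2) * (2 * x + 3) = 0 := by linear_combination -h1
    rcases mul_eq_zero.1 h with h | h
    · linarith
    · have h4 : x = -3 / 2 := by linarith
      rw [h4] at h2
      norm_num at h2
  · linarith
  · have h : (x - 2) * (x ^ 2 + 2 * x - 1) = 0 := by linear_combination -h1
    rcases mul_eq_zero.1 h with h | h
    · linarith
    · have e : x ^ 2 = 1 - 2 * x := by linarith
      rw [e] at h2
      -- Modulo x² + 2x - 1 the second equation becomes linear, with solution 5/6, which is not a
      -- root of that quadratic.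
      have h5 : x = 5 / 6 := by nlinarith
      rw [h5] at h
      norm_num at h
  · have h : (x - 2) * (2 * x + 1) = 0 := by linear_combination -h1
    rcases mul_eq_zero.1 h with h | h
    · linarith
    · have h4 : x = -1 / 2 := by linarith
      rw [h4] at h2
      norm_num at h2
  · linarith
  · have h : (x - 2) * (x ^ 2 - 2) = 0 := by linear_combination -h1
    rcases mul_eq_zero.1 h with h | h
    · linarith
    · rw [h] at h2
      norm_num at h2

/-- Elements of complex trace `x` are sent to conjugate non-central elements. -/
def IsCoincidence (l l' : List ℕ) (x : ℝ) : Prop :=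
  |x| ≤ 2 ∧ listChar l x = listChar l' x ∧ listChar l (x ^ 2 - 2) = listChar l' (x ^ 2 - 2) ∧
    listChar l (x ^ 3 - 3 * x) = listChar l' (x ^ 3 - 3 * x) ∧
    listChar l x ≠ 6 ∧ listChar l x ≠ -6

/-- The root used is 2 cos(2π/5), the trace of an element of order 5. -/
theorem exists_golden : ∃ x : ℝ, |x| ≤ 2 ∧ x ^ 2 + x - 1 = 0 := by
  have h5 : √5 ^ 2 = (5 : ℝ) := Real.sq_sqrt (by norm_num)
  have h1 : (1 : ℝ) ≤ √5 := Real.one_le_sqrt.2 (by norm_num)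
  have h3 : √5 ≤ (3 : ℝ) := Real.sqrt_le_iff.2 ⟨by norm_num, by norm_num⟩
  refine ⟨(√5 - 1) / 2, abs_le.2 ⟨by linarith, by linarith⟩, by linarith⟩

/-- At order 5 the weights ±5 of φ_5 become trivial, so φ_5 and 2φ_0 + φ_3 have the same
eigenvalues. Squaring and cubing exchange the two roots of x² + x - 1, so one computation on roots
covers all three powers. -/
theorem exists_isCoincidence_five : ∃ x, IsCoincidence [5] [0, 0, 3] x := by
  obtain ⟨x, hx, h⟩ := exists_golden
  have key : ∀ y : ℝ, y ^ 2 + y - 1 = 0 → listChar [5] y = 1 ∧ listChar [0, 0, 3] y = 1 := by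
    intro y hy
    simp [listChar]
    constructor
    · linear_combination (y ^ 3 - y ^ 2 - 2 * y + 1) * hy
    · linear_combination (y - 1) * hy
  have k1 := key x h
  have k2 := key (x ^ 2 - 2) (by linear_combination (x ^ 2 - x - 1) * h)
  have k3 := key (x ^ 3 - 3 * x)
    (by linear_combination (x ^ 4 - x ^ 3 - 4 * x ^ 2 + 4 * x + 1) * h)
  refine ⟨x, hx, ?_, ?_, ?_, ?_, ?_⟩
  · rw [k1.1, k1.2]
  · rw [k2.1, k2.2]
  · rw [k3.1, k3.2]
  · rw [k1.1]; norm_num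
  · rw [k1.1]; norm_num

theorem IsCoincidence.symm {l l' : List ℕ} {x : ℝ} (h : IsCoincidence l l' x) :
    IsCoincidence l' l x :=
  ⟨h.1, h.2.1.symm, h.2.2.1.symm, h.2.2.2.1.symm, h.2.1 ▸ h.2.2.2.2.1, h.2.1 ▸ h.2.2.2.2.2⟩

/-- The witnesses are the traces -1 (order 3) and 0 (order 4); only φ_5 against 2φ_0 + φ_3 needs
order 5. -/
theorem mem_pairTable_or_isCoincidence {l l' : List ℕ} (hl : l ∈ symplecticTypes)
    (hl' : l' ∈ symplecticTypes) :
    (l, l') ∈ pairTable ∨ (l', l) ∈ pairTable ∨ ∃ x, IsCoincidence l l' x := by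
  simp only [symplecticTypes, List.mem_cons, List.not_mem_nil, or_false] at hl hl'
  rcases hl with rfl | rfl | rfl | rfl | rfl | rfl | rfl <;>
    rcases hl' with rfl | rfl | rfl | rfl | rfl | rfl | rfl <;> first
      | exact Or.inl (by decide)
      | exact Or.inr (Or.inl (by decide))
      | (refine Or.inr (Or.inr ⟨-1, ?_⟩); norm_num [IsCoincidence, listChar]; done)
      | (refine Or.inr (Or.inr ⟨0, ?_⟩); norm_num [IsCoincidence, listChar]; done)
      | exact Or.inr (Or.inr exists_isCoincidence_five)
      | exact Or.inr (Or.inr (exists_isCoincidence_five.imp fun _ h => h.symm))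

/-! ### From characters to the biquotient action. -/

theorem not_isEffectivelyFree_of_isCoincidence {f₁ f₂ : SpOne →* Sp 3} {l l' : List ℕ} {x : ℝ}
    (h₁ : IsEquivalentTo f₁ l) (h₂ : IsEquivalentTo f₂ l') (hx : IsCoincidence l l' x) :
    ¬ IsEffectivelyFree (biquotientAction f₁ f₂) := by
  intro hfree
  obtain ⟨hx2, e1, e2, e3, n1, n2⟩ := hx
  set u := torus (Real.arccos (x / 2)) with hu
  have hre : (u : ℍ[ℝ]).re = x / 2 := by
    apply re_torus_arccos
    rw [abs_div, abs_two]
    linarith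
  have hu1 : 2 * (u : ℍ[ℝ]).re = x := by rw [hre]; ring
  have hu2 : 2 * ((u ^ 2 : SpOne) : ℍ[ℝ]).re = x ^ 2 - 2 := by rw [re_sq_spOne, hre]; ring
  have hu3 : 2 * ((u ^ 3 : SpOne) : ℍ[ℝ]).re = x ^ 3 - 3 * x := by rw [re_cube_spOne, hre]; ring
  obtain ⟨P, hP⟩ : ∃ P, f₁ u = P * f₂ u * P⁻¹ := by
    apply exists_conj_of_character_pow_eq
    intro m hm
    obtain ⟨hm1, hm3⟩ := Finset.mem_Icc.1 hm
    rw [← map_pow, ← map_pow, h₁.character, h₂.character]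
    congr 1
    interval_cases m
    · rw [pow_one, hu1, e1]
    · rw [hu2, e2]
    · rw [hu3, e3]
  -- The conjugating element P is a fixed point of u. If u then fixed everything, y = 1 would give
  -- f₁(u) = f₂(u) and arbitrary y would make it central, with trace ±6.
  have hfix : ∀ y, f₁ u * y * (f₂ u)⁻¹ = y := by
    refine hfree u P ?_
    change f₁ u * P * (f₂ u)⁻¹ = P
    rw [hP]
    group
  have h12 : f₁ u = f₂ u := by
    have := hfix 1
    rwa [mul_one, mul_inv_eq_one] at this
  have hcen : ∀ B, f₁ u * B = B * f₁ u := by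
    intro B
    have := hfix B
    rw [mul_inv_eq_iff_eq_mul] at this
    rw [this, h12]
  have hchar := character_eq_of_central hcen
  rw [h₁.character, hu1] at hchar
  rcases hchar with h | h
  · exact n1 (by exact_mod_cast h)
  · exact n2 (by exact_mod_cast h)

theorem eq_one_of_mem_pairTable {f₁ f₂ : SpOne →* Sp 3} {r : List ℕ × List ℕ}
    (hr : r ∈ pairTable) (h₁ : IsEquivalentTo f₁ r.1) (h₂ : IsEquivalentTo f₂ r.2) {u : SpOne}
    {g : Sp 3} (h : f₁ u = g * f₂ u * g⁻¹) : u = 1 := by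
  have hchar : ∀ m : ℕ, listChar r.1 (2 * ((u ^ m : SpOne) : ℍ[ℝ]).re) =
      listChar r.2 (2 * ((u ^ m : SpOne) : ℍ[ℝ]).re) := by
    intro m
    have h' : (stdRep 3).character (f₁ (u ^ m)) = (stdRep 3).character (f₂ (u ^ m)) := by
      rw [map_pow, map_pow, h, conj_pow, character_stdRep_conj]
    rw [h₁.character, h₂.character] at h'
    exact_mod_cast h'
  have h1 := hchar 1
  have h2 := hchar 2
  rw [pow_one] at h1
  have hsq : 2 * ((u ^ 2 : SpOne) : ℍ[ℝ]).re = (2 * (u : ℍ[ℝ]).re) ^ 2 - 2 := by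
    rw [re_sq_spOne]
    ring
  rw [hsq] at h2
  have hre := eq_two_of_mem_pairTable hr h1 h2
  have hs := u.sq_add_sq
  have hre1 : (u : ℍ[ℝ]).re = 1 := by linarith
  rw [hre1] at hs
  have hi := sq_nonneg (u : ℍ[ℝ]).imI
  have hj := sq_nonneg (u : ℍ[ℝ]).imJ
  have hk := sq_nonneg (u : ℍ[ℝ]).imK
  apply Subtype.ext
  apply Quaternion.ext
  · exact hre1
  all_goals
    refine pow_eq_zero_iff two_ne_zero |>.1 (le_antisymm ?_ (sq_nonneg _))
    linarith

end SpBiquotient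

end

theorem proposition3p2
    (f₁ f₂ : SpBiquotient.SpOne →* SpBiquotient.Sp 3)
    (hf₁ : Continuous f₁) (hf₂ : Continuous f₂) (hf₁_ne : f₁ ≠ 1) :
    SpBiquotient.IsEffectivelyFree (SpBiquotient.biquotientAction f₁ f₂) ↔
      f₂ = 1 ∨
        ∃ r ∈ SpBiquotient.pairTable,
          (SpBiquotient.IsEquivalentTo f₁ r.1 ∧ SpBiquotient.IsEquivalentTo f₂ r.2) ∨
          (SpBiquotient.IsEquivalentTo f₂ r.1 ∧ SpBiquotient.IsEquivalentTo f₁ r.2) := by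
  constructor
  · intro hfree
    refine or_iff_not_imp_left.2 fun hf₂_ne => ?_
    obtain ⟨l, hl, h₁⟩ := SpBiquotient.exists_isEquivalentTo hf₁ hf₁_ne
    obtain ⟨l', hl', h₂⟩ := SpBiquotient.exists_isEquivalentTo hf₂ hf₂_ne
    rcases SpBiquotient.mem_pairTable_or_isCoincidence hl hl' with h | h | ⟨x, hx⟩
    · exact ⟨_, h, Or.inl ⟨h₁, h₂⟩⟩
    · exact ⟨_, h, Or.inr ⟨h₂, h₁⟩⟩
    · exact absurd hfree (SpBiquotient.not_isEffectivelyFree_of_isCoincidence h₁ h₂ hx)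
  · intro h u g hg
    change f₁ u * g * (f₂ u)⁻¹ = g at hg
    suffices h1 : f₁ u = 1 ∧ f₂ u = 1 by
      intro y
      change f₁ u * y * (f₂ u)⁻¹ = y
      rw [h1.1, h1.2, one_mul, inv_one, mul_one]
    have hconj : f₁ u = g * f₂ u * g⁻¹ := by
      rw [mul_inv_eq_iff_eq_mul] at hg
      rw [← hg, mul_inv_cancel_right]
    -- If f₂ is trivial, f₁(u) is conjugate to 1 and so equals 1; for a table pair the conjugacy
    -- forces u = 1 itself.
    rcases h with rfl | ⟨r, hr, ⟨h₁, h₂⟩ | ⟨h₂, h₁⟩⟩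
    · simpa using hconj
    · rw [SpBiquotient.eq_one_of_mem_pairTable hr h₁ h₂ hconj]
      simp
    · have hconj' : f₂ u = g⁻¹ * f₁ u * g⁻¹⁻¹ := by
        rw [hconj]
        group
      rw [SpBiquotient.eq_one_of_mem_pairTable hr h₂ h₁ hconj']
      simp
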